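/- Let $d\ge 1$ and $0<\delta<1$. Let $\Omega=(\{0,1\}^d)^{\mathbb Z}$ with the product $\mathbb P$ of the uniform probability measures on $\{0,1\}^d$, and write $\mathbb E_\omega$ for the expectation with respect to $\mathbb P$. For $\omega\in\Omega$ let $\mathcal D_\omega$ be the dyadic grid consisting of the cubes $$2^k\big([p_1,p_1+1)\times\cdots\times[p_d,p_d+1)\big)+\sum_{j<k}\omega_j2^j,\qquad k\in\mathbb Z,\ p\in\mathbb Z^d,$$ of side length $\ell(Q)=2^k$. A Haar function associated with $Q\in\mathcal D_\omega$ is any real linear combination of the indicator functions of the $2^d$ cubes $R\in\mathcal D_\omega$ with $R\subset Q$ and $\ell(R)=\ell(Q)/2$. For integers $m,n\ge 0$, a bounded linear operator $\mathbb S$ on $L^2(\mathbb R^d)$ (real-valued functions) is a Haar shift on $\mathcal D_\omega$ of complexity type $(m,n)$ if $$\mathbb S f=\sum_{Q\in\mathcal D_\omega}\frac1{|Q|}\sum_{\substack{Q',Q''\in\mathcal D_\omega,\ Q',Q''\subset Q\\ \ell(Q')=2^{-m}\ell(Q),\ \ell(Q'')=2^{-n}\ell(Q)}}\langle f,h^{Q'}_{Q''}\rangle\,h^{Q''}_{Q'},\qquad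 f\in L^2(\mathbb R^d),$$ where $h^{Q'}_{Q''}$ and $h^{Q''}_{Q'}$ are Haar functions associated with $Q''$ and $Q'$ respectively, satisfying $|h^{Q'}_{Q''}(y)\,h^{Q''}_{Q'}(x)|\le 1$ for all $x,y\in\mathbb R^d$; the series is summed by scales, that is, the partial sums over $2^{-N}\le\ell(Q)\le 2^N$ converge to $\mathbb Sf$ weakly in $L^2$ as $N\to\infty$. There is a constant $C>0$, depending only on $d$ and $\delta$, such that the following holds. For all $m,n\ge 0$ and $\omega\in\Omega$ let $\lambda^\omega_{m,n}\in\mathbb R$ with $|\lambda^\omega_{m,n}|\le 2^{-(m+n)\delta}$, and let $\mathbb S^\omega_{m,n}$ be a Haar shift on $\mathcal D_\omega$ of complexity type $(m,n)$ with $\|\mathbb S^\omega_{m,n}\|_{L^2\to L^2}\le 1$, such that $\omega\mapsto\sum_{m,n}\lambda^\omega_{m,n}\langle\mathbb S^\omega_{m,n}f,g\rangle$ is $\mathbb P$-measurable for all $f,g\in L^2(\mathbb R^d)$. Then there is a bounded linear operator $S$ on $L^2(\mathbb R^d)$ with $$\langle Sf,g\rangle=\mathbb E_\omega\sum_{m,n\ge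 0}\lambda^\omega_{m,n}\langle\mathbb S^\omega_{m,n}f,g\rangle,\qquad f,g\in L^2(\mathbb R^d),$$ and $S$ is a Calderón–Zygmund operator with exponent $\delta$: there is a real-valued function $K$ on $\{(x,y)\in\mathbb R^d\times\mathbb R^d: x\ne y\}$ such that $$|K(x,y)|\le\frac{C}{|x-y|^d}\quad\text{for } x\ne y,$$ $$|K(x,y)-K(x',y)|+|K(y,x)-K(y,x')|\le C\,\frac{|x-x'|^\delta}{|x-y|^{\delta+d}}\quad\text{whenever } x\neq y,\ |x-x'|<\tfrac12|x-y|,$$ and $$\langle Sf,g\rangle=\iint f(y)g(x)K(x,y)\,dx\,dy$$ (an absolutely convergent integral) for all bounded measurable $f,g:\mathbb R^d\to\mathbb R$ with compact and disjoint supports. -/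

import Mathlib

open MeasureTheory Filter Topology

noncomputable section

namespace HaarShift

/-- The space `({0,1}^d)^ℤ` of doubly infinite sequences of binary `d`-tuples. -/
abbrev Omega (d : ℕ) : Type := ℤ → Fin d → Bool

/-- The product over `ℤ` of the uniform probability measure on `{0,1}^d`. -/
def prob (d : ℕ) : Measure (Omega d) :=
  Measure.infinitePi fun _ : ℤ => (PMF.uniformOfFintype (Fin d → Bool)).toMeasure

/-- The `i`-th coordinate of the translation vector `∑_{j < k} ω_j 2^j`. -/
def gridShift {d : ℕ} (ω : Omega d) (k : ℤ) (i : Fin d) : ℝ :=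
  ∑' j : {j : ℤ // j < k}, if ω j.1 i then (2 : ℝ) ^ j.1 else 0

/-- The names of the cubes of a dyadic grid: `⟨k, p⟩` names the standard dyadic cube
`2^k ([p_1, p_1 + 1) × ⋯ × [p_d, p_d + 1))` and its translates. -/
@[ext]
structure Cube (d : ℕ) where
  /-- The exponent `k` of the side length `2^k`. -/
  scale : ℤ
  /-- The position `p`. -/
  pos : Fin d → ℤ

/-- The side length. -/
def Cube.side {d : ℕ} (Q : Cube d) : ℝ := (2 : ℝ) ^ Q.scale

/-- The cube `Q + ω` of the grid `𝒟_ω`, as a set of points. -/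
def Cube.toSet {d : ℕ} (ω : Omega d) (Q : Cube d) : Set (EuclideanSpace ℝ (Fin d)) :=
  {x | ∀ i, Q.side * Q.pos i + gridShift ω Q.scale i ≤ x i ∧
    x i < Q.side * (Q.pos i + 1) + gridShift ω Q.scale i}

theorem descendants_finite {d : ℕ} (ω : Omega d) (m : ℕ) (Q : Cube d) :
    {R : Cube d | R.scale = Q.scale - m ∧ R.toSet ω ⊆ Q.toSet ω}.Finite := by
  have h2 : (0 : ℝ) < (2 : ℝ) ^ (Q.scale - m) := by positivity
  let s : Fin d → ℝ := gridShift ω (Q.scale - m)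
  let t : Fin d → ℝ := gridShift ω Q.scale
  let lo : Fin d → ℤ := fun i => ⌊(Q.side * Q.pos i + t i - s i) / (2 : ℝ) ^ (Q.scale - m)⌋
  let hi : Fin d → ℤ := fun i =>
    ⌈(Q.side * (Q.pos i + 1) + t i - s i) / (2 : ℝ) ^ (Q.scale - m)⌉
  refine ((Set.finite_Icc lo hi).image fun p => (⟨Q.scale - m, p⟩ : Cube d)).subset ?_
  rintro ⟨k, p⟩ ⟨hk, hR⟩
  dsimp only at hk
  subst hk
  have hx : (WithLp.toLp 2 fun i => (2 : ℝ) ^ (Q.scale - m) * p i + s i) ∈ Q.toSet ω := by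
    apply hR
    intro i
    simp only [Cube.side]
    refine ⟨le_rfl, ?_⟩
    show (2 : ℝ) ^ (Q.scale - m) * p i + s i < (2 : ℝ) ^ (Q.scale - m) * (p i + 1) + s i
    linarith
  refine ⟨p, ⟨fun i => ?_, fun i => ?_⟩, rfl⟩
  · have h := (hx i).1
    have h' : Q.side * Q.pos i + t i ≤ (2 : ℝ) ^ (Q.scale - m) * p i + s i := h
    have : (Q.side * Q.pos i + t i - s i) / (2 : ℝ) ^ (Q.scale - m) ≤ p i := by
      rw [div_le_iff₀ h2]; linarith
    exact Int.cast_le.mp ((Int.floor_le _).trans this)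
  · have h := (hx i).2
    have h' : (2 : ℝ) ^ (Q.scale - m) * p i + s i < Q.side * (Q.pos i + 1) + t i := h
    have : (p i : ℝ) ≤ (Q.side * (Q.pos i + 1) + t i - s i) / (2 : ℝ) ^ (Q.scale - m) := by
      rw [le_div_iff₀ h2]; linarith
    exact Int.cast_le.mp (this.trans (Int.le_ceil _))

/-- The cubes `R ∈ 𝒟_ω` with `R ⊆ Q` and side length `2^{-m}` times that of `Q`;
for `m = 1` these are the children of `Q`. -/
def descendants {d : ℕ} (ω : Omega d) (m : ℕ) (Q : Cube d) : Finset (Cube d) :=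
  (descendants_finite ω m Q).toFinset

/-- `h` is a Haar function associated with `Q`: a linear combination of the indicators of the
children of `Q` (no cancellation is required). -/
def IsHaarFunction {d : ℕ} (ω : Omega d) (Q : Cube d) (h : EuclideanSpace ℝ (Fin d) → ℝ) : Prop :=
  ∃ c : Cube d → ℝ, ∀ x, h x = ∑ R ∈ descendants ω 1 Q, c R * (R.toSet ω).indicator 1 x

/-- The part of the series of a Haar shift that belongs to the cubes `Q` of side length `2^k`.
Here `hin Q' Q''` is the Haar function on `Q''` against which `f` is integrated and
`hout Q' Q''` is the Haar function on `Q'`. For each `x` at most one term of the outer sum is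
nonzero. -/
def scalePart {d : ℕ} (ω : Omega d) (m n : ℕ)
    (hin hout : Cube d → Cube d → EuclideanSpace ℝ (Fin d) → ℝ) (k : ℤ)
    (f : EuclideanSpace ℝ (Fin d) → ℝ) (x : EuclideanSpace ℝ (Fin d)) : ℝ :=
  ∑' p : Fin d → ℤ, (1 / (Cube.mk k p).side ^ d) *
    ∑ Q' ∈ descendants ω m ⟨k, p⟩, ∑ Q'' ∈ descendants ω n ⟨k, p⟩,
      (∫ y, f y * hin Q' Q'' y) * hout Q' Q'' x

/-- `S` is a Haar shift on `𝒟_ω` of complexity type `(m, n)`. The series over the cubes `Q` is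
summed in the order of the scales and converges to `S f` weakly in `L²`. -/
def IsHaarShift {d : ℕ} (ω : Omega d) (m n : ℕ)
    (S : Lp ℝ 2 (volume : Measure (EuclideanSpace ℝ (Fin d))) →L[ℝ]
      Lp ℝ 2 (volume : Measure (EuclideanSpace ℝ (Fin d)))) : Prop :=
  ∃ hin hout : Cube d → Cube d → EuclideanSpace ℝ (Fin d) → ℝ,
    (∀ Q : Cube d, ∀ Q' ∈ descendants ω m Q, ∀ Q'' ∈ descendants ω n Q,
      IsHaarFunction ω Q'' (hin Q' Q'') ∧ IsHaarFunction ω Q' (hout Q' Q'') ∧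
      ∀ x y, |hin Q' Q'' y * hout Q' Q'' x| ≤ 1) ∧
    ∀ f g : Lp ℝ 2 (volume : Measure (EuclideanSpace ℝ (Fin d))),
      Tendsto
        (fun N : ℕ => ∫ x, (∑ k ∈ Finset.Icc (-(N : ℤ)) N, scalePart ω m n hin hout k f x) * g x)
        atTop (𝓝 (inner ℝ (S f) g))

/-- `K` is a standard kernel with constant `C` and smoothness exponent `δ`. The values of `K` on
the diagonal are irrelevant. -/
structure IsStandardKernel {d : ℕ} (C δ : ℝ)
    (K : EuclideanSpace ℝ (Fin d) → EuclideanSpace ℝ (Fin d) → ℝ) : Prop where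
  size : ∀ x y, x ≠ y → |K x y| ≤ C / ‖x - y‖ ^ d
  smooth : ∀ x x' y, x ≠ y → ‖x - x'‖ < ‖x - y‖ / 2 →
    |K x y - K x' y| + |K y x - K y x'| ≤ C * ‖x - x'‖ ^ δ / ‖x - y‖ ^ (δ + d)

/-- The bounded operator `T` on `L²` is represented by `K` off the diagonal. -/
def IsRepresentedBy {d : ℕ}
    (T : Lp ℝ 2 (volume : Measure (EuclideanSpace ℝ (Fin d))) →L[ℝ]
      Lp ℝ 2 (volume : Measure (EuclideanSpace ℝ (Fin d))))
    (K : EuclideanSpace ℝ (Fin d) → EuclideanSpace ℝ (Fin d) → ℝ) : Prop :=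
  ∀ (f g : EuclideanSpace ℝ (Fin d) → ℝ) (hf : MemLp f 2 volume) (hg : MemLp g 2 volume),
    (∃ B, ∀ x, |f x| ≤ B) → (∃ B, ∀ x, |g x| ≤ B) →
    HasCompactSupport f → HasCompactSupport g → Disjoint (tsupport f) (tsupport g) →
    Integrable (fun p : EuclideanSpace ℝ (Fin d) × EuclideanSpace ℝ (Fin d) =>
      f p.2 * g p.1 * K p.1 p.2) (volume.prod volume) ∧
    inner ℝ (T (hf.toLp f)) (hg.toLp g) = ∫ y, ∫ x, f y * g x * K x y

/-- `T` is a Calderón–Zygmund operator with kernel constant `C` and smoothness exponent `δ`. -/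
def IsCalderonZygmund {d : ℕ} (C δ : ℝ)
    (T : Lp ℝ 2 (volume : Measure (EuclideanSpace ℝ (Fin d))) →L[ℝ]
      Lp ℝ 2 (volume : Measure (EuclideanSpace ℝ (Fin d)))) : Prop :=
  ∃ K : EuclideanSpace ℝ (Fin d) → EuclideanSpace ℝ (Fin d) → ℝ,
    IsStandardKernel C δ K ∧ IsRepresentedBy T K

end HaarShift

end

noncomputable section

namespace HaarShift

open scoped ENNReal

/-! The kernel of a shift of type `(m, n)` at scale `2^k` is at most `2^{-kd}`, vanishes when `|x -
y| > d 2^k`, and is constant in `x` on grid cubes of side `2^{k-m-1}` and in `y` on those of side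
`2^{k-n-1}`. The size estimate holds for each grid separately: sum `2^{-(m+n)δ} 2^{-kd}` over `m`,
`n` and the scales `2^k ≥ |x - y| / d`. Smoothness appears only after averaging. A single kernel
jumps, but it differs at `x` and `x'` only if a cube of side `2^{k-m-1}` separates them, an event of
probability at most a constant times `min 1 (|x - x'| / 2^{k-m-1})`. Summing against `2^{-mδ}` turns
this into `(|x - x'| / 2^k)^δ`; both `0 < δ` and `δ < 1` are needed for convergence. The sum over
`k` then gives `|x - x'|^δ / |x - y|^(δ + d)`. The difficulty is measurability: only the total
pairings are measurable in `ω`, not the kernels, whose Haar functions are chosen separately for each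
grid. The expectation is therefore replaced by a linear functional `Λ` on all functions of `ω`,
dominated by the upper integral, and the kernel is `Λ` of the pointwise sum. The estimates survive
because their majorants in `ω` are measurable. Fubini is replaced by `integral_linear_extension`: by
`exists_oscillation_majorant` the kernels are equicontinuous in upper mean off the diagonal, so `Λ`
commutes with integration against `f(y) g(x)`. -/

/-! ### Extension of the integral to non-measurable functions. -/

/-- The functions dominated almost everywhere by an integrable function; no measurability is
required. -/
def dominatedSubmodule {Ω : Type*} [MeasurableSpace Ω] (μ : Measure Ω) :
    Submodule ℝ (Ω → ℝ) where
  carrier := {F | ∃ G, Integrable G μ ∧ ∀ᵐ ω ∂μ, |F ω| ≤ G ω}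
  zero_mem' := ⟨0, integrable_zero _ _ _, by simp⟩
  add_mem' := by
    rintro F F' ⟨G, hG, h⟩ ⟨G', hG', h'⟩
    refine ⟨G + G', hG.add hG', ?_⟩
    filter_upwards [h, h'] with ω h1 h2
    exact (abs_add_le _ _).trans (add_le_add h1 h2)
  smul_mem' := by
    rintro c F ⟨G, hG, h⟩
    refine ⟨|c| • G, hG.smul _, ?_⟩
    filter_upwards [h] with ω h1
    simp only [Pi.smul_apply, smul_eq_mul, abs_mul]
    gcongr

/-- The integral, as a linear functional on the integrable functions. -/
def integralPMap {Ω : Type*} [MeasurableSpace Ω] (μ : Measure Ω) :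
    dominatedSubmodule μ →ₗ.[ℝ] ℝ where
  domain :=
    { carrier := {F | Integrable F.1 μ}
      zero_mem' := integrable_zero _ _ _
      add_mem' := fun h h' => Integrable.add h h'
      smul_mem' := fun c _ h => Integrable.smul c h }
  toFun :=
    { toFun := fun F => ∫ ω, F.1.1 ω ∂μ
      map_add' := fun F G => integral_add F.2 G.2
      map_smul' := fun c _ => integral_const_mul c _ }

/-- The integral extends to a linear functional on all functions which is controlled by the upper
integral. -/
theorem exists_linear_extension_integral {Ω : Type*} [MeasurableSpace Ω] (μ : Measure Ω) :
    ∃ Λ : (Ω → ℝ) →ₗ[ℝ] ℝ, (∀ F, Integrable F μ → Λ F = ∫ ω, F ω ∂μ) ∧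
      ∀ (F : Ω → ℝ) (G : Ω → ℝ≥0∞), AEMeasurable G μ → (∀ ω, ‖F ω‖ₑ ≤ G ω) →
        ‖Λ F‖ₑ ≤ ∫⁻ ω, G ω ∂μ := by
  let s : PointedCone ℝ (dominatedSubmodule μ) :=
    { carrier := {F | ∀ᵐ ω ∂μ, 0 ≤ F.1 ω}
      zero_mem' := by simp
      add_mem' := by
        intro F F' h h'
        change ∀ᵐ ω ∂μ, 0 ≤ F.1 ω + F'.1 ω
        filter_upwards [h, h'] with ω h1 h2
        exact add_nonneg h1 h2
      smul_mem' := by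
        intro c F h
        change ∀ᵐ ω ∂μ, 0 ≤ c.1 * F.1 ω
        filter_upwards [h] with ω h1
        exact mul_nonneg c.2 h1 }
  -- Positivity extends from the integrable functions because adding its integrable majorant to a
  -- dominated function makes it nonnegative.
  obtain ⟨g, hg, hpos⟩ := riesz_extension s (integralPMap μ)
    (fun F hF => integral_nonneg_of_ae hF) (by
      rintro ⟨F, G, hG, h⟩
      refine ⟨⟨⟨G, G, hG, ?_⟩, hG⟩, ?_⟩
      · filter_upwards [h] with ω h1
        rw [abs_of_nonneg ((abs_nonneg _).trans h1)]
      · filter_upwards [h] with ω h1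
        have := neg_abs_le (F ω)
        simp only [Submodule.coe_add, Pi.add_apply]
        linarith)
  -- Beyond the dominated functions any linear extension will do: a function without an integrable
  -- majorant has only majorants `G` of infinite integral. For a dominated function the bound
  -- follows from positivity on `G - F` and `G + F`.
  obtain ⟨Λ, hΛ⟩ := LinearMap.exists_extend g
  have hΛ' : ∀ F (hF : F ∈ dominatedSubmodule μ), Λ F = g ⟨F, hF⟩ := by
    intro F hF
    rw [← hΛ]; rfl
  have hint : ∀ F, Integrable F μ → Λ F = ∫ ω, F ω ∂μ := by
    intro F hF
    have hm : F ∈ dominatedSubmodule μ := ⟨fun ω => |F ω|, hF.abs, by simp⟩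
    rw [hΛ' F hm]
    exact hg ⟨⟨F, hm⟩, hF⟩
  refine ⟨Λ, hint, ?_⟩
  intro F G hG hFG
  rcases eq_or_ne (∫⁻ ω, G ω ∂μ) ∞ with htop | htop
  · rw [htop]; exact le_top
  have hGi : Integrable (fun ω => (G ω).toReal) μ := integrable_toReal_of_lintegral_ne_top hG htop
  have hfin : ∀ᵐ ω ∂μ, G ω < ∞ := ae_lt_top' hG htop
  have hFle : ∀ᵐ ω ∂μ, |F ω| ≤ (G ω).toReal := by
    filter_upwards [hfin] with ω hω
    rw [← Real.norm_eq_abs, ← toReal_enorm]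
    exact ENNReal.toReal_mono hω.ne (hFG ω)
  have hm : F ∈ dominatedSubmodule μ := ⟨_, hGi, hFle⟩
  have hGm : (fun ω => (G ω).toReal) ∈ dominatedSubmodule μ := ⟨_, hGi, by simp⟩
  have h1 := hpos (⟨_, hGm⟩ - ⟨F, hm⟩) (by
    filter_upwards [hFle] with ω hω
    exact sub_nonneg.2 ((le_abs_self _).trans hω))
  have h2 := hpos (⟨_, hGm⟩ + ⟨F, hm⟩) (by
    filter_upwards [hFle] with ω hω
    have := neg_abs_le (F ω)
    simp only [Submodule.coe_add, Pi.add_apply]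
    linarith)
  rw [map_sub, ← hΛ' _ hGm, ← hΛ' _ hm, hint _ hGi, integral_toReal hG hfin] at h1
  rw [map_add, ← hΛ' _ hGm, ← hΛ' _ hm, hint _ hGi, integral_toReal hG hfin] at h2
  rw [← ofReal_norm, Real.norm_eq_abs]
  exact ENNReal.ofReal_le_of_le_toReal (abs_le.2 ⟨by linarith, by linarith⟩)

/-! ### Interchange of the extended functional with integrals. -/

/-- A compact set has finite measurable nearest point maps of arbitrary fineness. -/
theorem exists_simpleFunc_dist_lt {α : Type*} [MetricSpace α] [MeasurableSpace α]
    [OpensMeasurableSpace α] {Z : Set α} (hZ : IsCompact Z) (hne : Z.Nonempty) {r : ℝ}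
    (hr : 0 < r) :
    ∃ φ : SimpleFunc α α, (∀ z, φ z ∈ Z) ∧ ∀ z ∈ Z, dist z (φ z) < r := by
  obtain ⟨t, htZ, htf, hcov⟩ := hZ.finite_cover_balls hr
  have htne : t.Nonempty := by
    obtain ⟨z, hz⟩ := hne
    obtain ⟨i, hi, -⟩ := Set.mem_iUnion₂.1 (hcov hz)
    exact ⟨i, hi⟩
  obtain ⟨e, he⟩ := htf.countable.exists_eq_range htne
  -- `SimpleFunc.nearestPt e N` sees only the points `e 0, …, e N`, so `N` must be large enough for
  -- these to exhaust the finite net `t`.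
  have hbd : ∃ N : ℕ, ∀ z ∈ t, ∃ k ≤ N, e k = z := by
    have hch : ∀ z : α, ∃ k, z ∈ t → e k = z := by
      intro z
      by_cases hz : z ∈ t
      · rw [he] at hz
        obtain ⟨k, hk⟩ := hz
        exact ⟨k, fun _ => hk⟩
      · exact ⟨0, fun h => absurd h hz⟩
    choose k hk using hch
    refine ⟨htf.toFinset.sup k, fun z hz => ⟨k z, ?_, hk z hz⟩⟩
    exact Finset.le_sup (f := k) (htf.mem_toFinset.2 hz)
  obtain ⟨N, hN⟩ := hbd
  refine ⟨SimpleFunc.nearestPt e N, fun z => ?_, fun z hz => ?_⟩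
  · apply htZ
    rw [he]
    exact ⟨_, rfl⟩
  · obtain ⟨i, hi, hzi⟩ := Set.mem_iUnion₂.1 (hcov hz)
    obtain ⟨k, hk, rfl⟩ := hN i hi
    have h := SimpleFunc.edist_nearestPt_le e z hk
    rw [edist_dist, edist_dist, ENNReal.ofReal_le_ofReal_iff dist_nonneg] at h
    rw [dist_comm]
    refine h.trans_lt ?_
    rw [dist_comm]
    exact hzi

/-- The integral is a finite linear combination of values of `h`, with no measurability of `h`
required. A merely linear functional can thus be moved inside. -/
theorem integral_mul_comp_simpleFunc {α : Type*} [MeasurableSpace α] {ν : Measure α} {w : α → ℝ}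
    (hw : Integrable w ν) {β : Type*} [MeasurableSpace β] [MeasurableSingletonClass β]
    (φ : SimpleFunc α β) (h : β → ℝ) :
    Integrable (fun z => w z * h (φ z)) ν ∧
      ∫ z, w z * h (φ z) ∂ν = ∑ b ∈ φ.range, h b * ∫ z in φ ⁻¹' {b}, w z ∂ν := by
  have key : (fun z => w z * h (φ z)) =
      fun z => ∑ b ∈ φ.range, h b * (φ ⁻¹' {b}).indicator w z := by
    funext z
    rw [Finset.sum_eq_single (φ z)]
    · simp [mul_comm]
    · intro b _ hb
      rw [Set.indicator_of_notMem (by simpa using hb.symm), mul_zero]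
    · intro hz
      exact absurd (φ.mem_range_self z) hz
  have hi : ∀ b ∈ φ.range, Integrable (fun z => h b * (φ ⁻¹' {b}).indicator w z) ν :=
    fun b _ => (hw.indicator (φ.measurableSet_preimage _)).const_mul _
  rw [key]
  refine ⟨integrable_finsetSum _ hi, ?_⟩
  rw [integral_finsetSum _ hi]
  refine Finset.sum_congr rfl fun b _ => ?_
  rw [integral_const_mul, integral_indicator (φ.measurableSet_preimage _)]

/-- A linear functional controlled by the upper integral commutes with integration over a compact
set of parameters, when the integrand is equicontinuous with respect to the upper integral. -/
theorem integral_linear_extension {Ω : Type*} [MeasurableSpace Ω] {μ : Measure Ω}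
    {Λ : (Ω → ℝ) →ₗ[ℝ] ℝ}
    (hΛ : ∀ (F : Ω → ℝ) (G : Ω → ℝ≥0∞), AEMeasurable G μ → (∀ ω, ‖F ω‖ₑ ≤ G ω) →
        ‖Λ F‖ₑ ≤ ∫⁻ ω, G ω ∂μ)
    {α : Type*} [MetricSpace α] [MeasurableSpace α] [BorelSpace α] {ν : Measure α}
    {Z : Set α} (hZ : IsCompact Z) {w : α → ℝ} (hw : Integrable w ν) (hwZ : ∀ z ∉ Z, w z = 0)
    {k : Ω → α → ℝ} (hk : ∀ ω, Integrable (fun z => w z * k ω z) ν)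
    (hequi : ∀ ε : ℝ, 0 < ε → ∃ r : ℝ, 0 < r ∧ ∀ z₀ ∈ Z, ∃ M : Ω → ℝ≥0∞, Measurable M ∧
      (∀ ω, M ω ≠ ∞) ∧ ∫⁻ ω, M ω ∂μ ≤ ENNReal.ofReal ε ∧ ∀ z ∈ Z, dist z z₀ < r →
        ∀ ω, ‖k ω z - k ω z₀‖ₑ ≤ M ω) :
    Integrable (fun z => w z * Λ (fun ω => k ω z)) ν ∧
      Λ (fun ω => ∫ z, w z * k ω z ∂ν) = ∫ z, w z * Λ (fun ω => k ω z) ∂ν := by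
  rcases Z.eq_empty_or_nonempty with rfl | hne
  · have : w = 0 := by funext z; exact hwZ z (by simp)
    subst this
    simp only [Pi.zero_apply, zero_mul, integral_zero]
    exact ⟨integrable_zero _ _ _, map_zero Λ⟩
  set κ : α → ℝ := fun z => Λ (fun ω => k ω z) with hκ
  -- Discretizing `z` by a net in `Z` makes the integral a finite sum, with which `Λ` commutes. The
  -- majorant of the error is the sum of the finitely many `M b`, weighted by the mass of `|w|` on
  -- the cells.
  have happrox : ∀ ε : ℝ, 0 < ε → ∃ φ : SimpleFunc α α, (∀ z ∈ Z, |κ z - κ (φ z)| ≤ ε) ∧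
      |Λ (fun ω => ∫ z, w z * k ω z ∂ν) - ∫ z, w z * κ (φ z) ∂ν| ≤ ε * ∫ z, |w z| ∂ν := by
    intro ε hε
    obtain ⟨r, hr, hM⟩ := hequi ε hε
    obtain ⟨φ, hφZ, hφ⟩ := exists_simpleFunc_dist_lt hZ hne hr
    choose! M hMm hMt hMi hMk using hM
    refine ⟨φ, ?_, ?_⟩
    · intro z hz
      have h1 := hΛ ((fun ω => k ω z) - fun ω => k ω (φ z)) (M (φ z)) (hMm _ (hφZ z)).aemeasurable
        (fun ω => hMk (φ z) (hφZ z) z hz (hφ z hz) ω)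
      rw [map_sub] at h1
      have h2 := h1.trans (hMi _ (hφZ z))
      rw [← ofReal_norm, ENNReal.ofReal_le_ofReal_iff hε.le] at h2
      exact h2
    · have hsum : ∫ z, w z * κ (φ z) ∂ν = Λ (fun ω => ∫ z, w z * k ω (φ z) ∂ν) := by
        have : (fun ω => ∫ z, w z * k ω (φ z) ∂ν) =
            ∑ b ∈ φ.range, (∫ z in φ ⁻¹' {b}, w z ∂ν) • (fun ω => k ω b) := by
          funext ω
          rw [(integral_mul_comp_simpleFunc hw φ (k ω)).2, Finset.sum_apply]
          refine Finset.sum_congr rfl fun b _ => ?_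
          simp [mul_comm]
        rw [this, map_sum, (integral_mul_comp_simpleFunc hw φ κ).2]
        refine Finset.sum_congr rfl fun b _ => ?_
        rw [map_smul, smul_eq_mul, mul_comm]
      have hwa : Integrable (fun z => |w z|) ν := hw.abs
      rw [hsum, ← map_sub]
      have hle := hΛ ((fun ω => ∫ z, w z * k ω z ∂ν) - fun ω => ∫ z, w z * k ω (φ z) ∂ν)
        (fun ω => ∑ b ∈ φ.range, M b ω * ENNReal.ofReal (∫ z in φ ⁻¹' {b}, |w z| ∂ν)) ?_ ?_
      · have hrng : ∀ b ∈ φ.range, b ∈ Z := by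
          intro b hb
          obtain ⟨z, rfl⟩ := SimpleFunc.mem_range.1 hb
          exact hφZ z
        have hfin : ∫⁻ ω, ∑ b ∈ φ.range, M b ω * ENNReal.ofReal (∫ z in φ ⁻¹' {b}, |w z| ∂ν) ∂μ
            ≤ ENNReal.ofReal (ε * ∫ z, |w z| ∂ν) := by
          rw [lintegral_finsetSum' _ fun b hb => ((hMm b (hrng b hb)).mul_const _).aemeasurable]
          have h1 := (integral_mul_comp_simpleFunc hwa φ (fun _ => ε)).2
          rw [integral_mul_const, mul_comm] at h1
          rw [h1, ENNReal.ofReal_sum_of_nonneg fun b _ => by positivity]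
          refine Finset.sum_le_sum fun b hb => ?_
          rw [lintegral_mul_const _ (hMm b (hrng b hb)), ENNReal.ofReal_mul hε.le]
          gcongr
          exact hMi b (hrng b hb)
        have h2 := hle.trans hfin
        rw [← ofReal_norm, ENNReal.ofReal_le_ofReal_iff (by positivity)] at h2
        exact h2
      · refine Finset.aemeasurable_fun_sum _ fun b hb => ?_
        obtain ⟨z, rfl⟩ := SimpleFunc.mem_range.1 hb
        exact ((hMm _ (hφZ z)).mul_const _).aemeasurable
      · intro ω
        have hint := (integral_mul_comp_simpleFunc hw φ (k ω)).1
        have hb := integral_mul_comp_simpleFunc hwa φ (fun b => (M b ω).toReal)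
        have h1 : |(∫ z, w z * k ω z ∂ν) - ∫ z, w z * k ω (φ z) ∂ν| ≤
            ∫ z, |w z| * (M (φ z) ω).toReal ∂ν := by
          rw [← integral_sub (hk ω) hint, ← Real.norm_eq_abs]
          refine norm_integral_le_of_norm_le hb.1 (Eventually.of_forall fun z => ?_)
          rw [← mul_sub, norm_mul, Real.norm_eq_abs]
          by_cases hz : z ∈ Z
          · gcongr
            rw [← toReal_enorm]
            exact ENNReal.toReal_mono (hMt _ (hφZ z) ω) (hMk _ (hφZ z) z hz (hφ z hz) ω)
          · simp [hwZ z hz]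
        rw [hb.2] at h1
        simp only [Pi.sub_apply]
        rw [← ofReal_norm, Real.norm_eq_abs]
        refine (ENNReal.ofReal_le_ofReal h1).trans ?_
        rw [ENNReal.ofReal_sum_of_nonneg fun b _ => by positivity]
        refine Finset.sum_le_sum fun b _ => ?_
        rw [ENNReal.ofReal_mul ENNReal.toReal_nonneg]
        gcongr
        exact ENNReal.ofReal_toReal_le
  have hinv : ∀ n : ℕ, (0 : ℝ) < 1 / ((n : ℝ) + 1) := fun n => by positivity
  choose φ hφκ hφΛ using fun n : ℕ => happrox _ (hinv n)
  have hlim : ∀ z, Tendsto (fun n => w z * κ (φ n z)) atTop (𝓝 (w z * κ z)) := by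
    intro z
    by_cases hz : z ∈ Z
    · refine Tendsto.const_mul _ ?_
      rw [tendsto_iff_norm_sub_tendsto_zero]
      refine squeeze_zero (fun _ => norm_nonneg _) (fun n => ?_)
        tendsto_one_div_add_atTop_nhds_zero_nat
      rw [norm_sub_rev]
      exact hφκ n z hz
    · simp [hwZ z hz]
  -- No measurability of `κ` is known a priori; it comes from the limit of the discretizations. The
  -- domination uses `φ 0`, whose error is at most `1`.
  have hint : Integrable (fun z => w z * κ z) ν := by
    have h0 := integral_mul_comp_simpleFunc hw (φ 0) κ
    have hmeas : AEStronglyMeasurable (fun z => w z * κ z) ν :=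
      aestronglyMeasurable_of_tendsto_ae atTop
        (fun n => (integral_mul_comp_simpleFunc hw (φ n) κ).1.aestronglyMeasurable)
        (Eventually.of_forall hlim)
    refine Integrable.mono' (h0.1.abs.add (hw.abs.mul_const 1)) hmeas
      (Eventually.of_forall fun z => ?_)
    simp only [Pi.add_apply, norm_mul, Real.norm_eq_abs, abs_mul]
    by_cases hz : z ∈ Z
    · have h1 := hφκ 0 z hz
      have h2 : |κ z| ≤ |κ (φ 0 z)| + 1 := by
        have := abs_sub_abs_le_abs_sub (κ z) (κ (φ 0 z))
        norm_num at h1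
        linarith
      calc |w z| * |κ z| ≤ |w z| * (|κ (φ 0 z)| + 1) := by gcongr
        _ = _ := by ring
    · simp [hwZ z hz]
  refine ⟨hint, ?_⟩
  refine eq_of_abs_sub_le_all fun ε hε => ?_
  set W := ∫ z, |w z| ∂ν with hW
  have hW0 : 0 ≤ W := by positivity
  have hη : 0 < ε / (2 * (W + 1)) := by positivity
  obtain ⟨ψ, h1, h2⟩ := happrox _ hη
  have h3 : |(∫ z, w z * κ (ψ z) ∂ν) - ∫ z, w z * κ z ∂ν| ≤ (ε / (2 * (W + 1))) * W := by
    rw [← integral_sub (integral_mul_comp_simpleFunc hw ψ κ).1 hint, ← Real.norm_eq_abs, hW,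
      ← integral_const_mul]
    refine norm_integral_le_of_norm_le (hw.abs.const_mul _) (Eventually.of_forall fun z => ?_)
    rw [← mul_sub, norm_mul, Real.norm_eq_abs, Real.norm_eq_abs, mul_comm]
    by_cases hz : z ∈ Z
    · rw [abs_sub_comm]
      gcongr
      exact h1 z hz
    · simp [hwZ z hz]
  have h4 : (ε / (2 * (W + 1))) * W ≤ ε / 2 := by
    rw [div_mul_eq_mul_div, div_le_div_iff₀ (by positivity) (by positivity)]
    nlinarith
  calc _ ≤ _ := abs_sub_le _ (∫ z, w z * κ (ψ z) ∂ν) _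
    _ ≤ ε := by linarith

/-! ### Binary digits of the grid shifts and the distribution of cube faces. -/

variable {d : ℕ}

/-- An enumeration of the integers below `k`, in decreasing order. -/
def natEquivLT (k : ℤ) : ℕ ≃ {j : ℤ // j < k} where
  toFun l := ⟨k - 1 - l, by omega⟩
  invFun j := (k - 1 - j.1).toNat
  left_inv l := by simp
  right_inv j := by
    ext
    have := j.2
    simp only
    omega

theorem gridShift_eq_tsum_nat (ω : Omega d) (k : ℤ) (i : Fin d) :
    gridShift ω k i =
      ∑' l : ℕ, if ω (k - 1 - l) i then (2 : ℝ) ^ (k - 1 - l : ℤ) else 0 := by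
  rw [gridShift, ← (natEquivLT k).tsum_eq]
  rfl

theorem two_zpow_sub_natCast (k : ℤ) (l : ℕ) :
    (2 : ℝ) ^ (k - 1 - l : ℤ) = 2 ^ (k - 1) * (1 / 2) ^ l := by
  rw [zpow_sub₀ two_ne_zero, zpow_natCast, div_eq_mul_inv, one_div, inv_pow]

theorem summable_gridShift (ω : Omega d) (k : ℤ) (i : Fin d) :
    Summable fun l : ℕ => if ω (k - 1 - l) i then (2 : ℝ) ^ (k - 1 - l : ℤ) else 0 := by
  refine Summable.of_nonneg_of_le (fun l => by positivity) (fun l => ?_)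
    (summable_geometric_two.mul_left ((2 : ℝ) ^ (k - 1)))
  rw [← two_zpow_sub_natCast]
  split_ifs
  · exact le_rfl
  · positivity

theorem gridShift_nonneg (ω : Omega d) (k : ℤ) (i : Fin d) : 0 ≤ gridShift ω k i :=
  tsum_nonneg fun _ => by positivity

theorem gridShift_le (ω : Omega d) (k : ℤ) (i : Fin d) : gridShift ω k i ≤ 2 ^ k := by
  rw [gridShift_eq_tsum_nat]
  calc _ ≤ ∑' l : ℕ, (2 : ℝ) ^ (k - 1) * (1 / 2) ^ l := by
        refine (summable_gridShift ω k i).tsum_le_tsum (fun l => ?_)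
          (summable_geometric_two.mul_left _)
        rw [← two_zpow_sub_natCast]
        split_ifs
        · exact le_rfl
        · positivity
    _ = 2 ^ k := by
        rw [tsum_mul_left, tsum_geometric_two, ← zpow_add_one₀ two_ne_zero]
        simp

theorem gridShift_succ (ω : Omega d) (k : ℤ) (i : Fin d) :
    gridShift ω (k + 1) i = (if ω k i then (2 : ℝ) ^ k else 0) + gridShift ω k i := by
  rw [gridShift_eq_tsum_nat, (summable_gridShift ω (k + 1) i).tsum_eq_zero_add,
    gridShift_eq_tsum_nat]
  congr 1
  · simp
  · refine tsum_congr fun l => ?_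
    have : k + 1 - 1 - ((l + 1 : ℕ) : ℤ) = k - 1 - l := by push_cast; ring
    rw [this]

/-- The integer with binary digits `ω_N, …, ω_{N + n - 1}` in direction `i`. -/
def binCode (ω : Omega d) (N : ℤ) (n : ℕ) (i : Fin d) : ℕ :=
  ∑ l ∈ Finset.range n, if ω (N + l) i then 2 ^ l else 0

/-- Relative to the grid of side `2^N`, the faces of the grid of side `2^(N+n)` sit at an integer
position fixed modulo `2^n` by `n` fair bits. All the randomness used below is in this integer. -/
theorem gridShift_add (ω : Omega d) (N : ℤ) (n : ℕ) (i : Fin d) :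
    gridShift ω (N + n) i = 2 ^ N * binCode ω N n i + gridShift ω N i := by
  induction n with
  | zero => simp [binCode]
  | succ n ih =>
    have h : N + ((n + 1 : ℕ) : ℤ) = N + n + 1 := by push_cast; ring
    rw [h, gridShift_succ, ih]
    simp only [binCode, Finset.sum_range_succ]
    rw [zpow_add₀ two_ne_zero, zpow_natCast]
    split_ifs <;> push_cast <;> ring

theorem binCode_eq_imp {ω ω' : Omega d} {N : ℤ} {n : ℕ} {i : Fin d}
    (h : binCode ω N n i = binCode ω' N n i) (l : ℕ) (hl : l < n) : ω (N + l) i = ω' (N + l) i := by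
  simp only [binCode, ← Finset.sum_filter] at h
  have h' := Finset.geomSum_injective le_rfl h
  have := Finset.ext_iff.1 h' l
  simp only [Finset.mem_filter, Finset.mem_range, hl, true_and] at this
  exact Bool.eq_iff_iff.2 this

theorem measurable_binCode (N : ℤ) (n : ℕ) (i : Fin d) :
    Measurable fun ω : Omega d => binCode ω N n i := by
  unfold binCode
  refine Finset.measurable_fun_sum _ fun l _ => ?_
  refine Measurable.ite ?_ measurable_const measurable_const
  have : Measurable fun ω : Omega d => ω (N + l) i :=
    (measurable_pi_apply i).comp (measurable_pi_apply (N + (l : ℤ)))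
  exact this (measurableSet_singleton true)

theorem uniform_coord_eq (i : Fin d) (c : Bool) :
    (PMF.uniformOfFintype (Fin d → Bool)).toMeasure {b | b i = c} = 2⁻¹ := by
  classical
  obtain ⟨e, rfl⟩ : ∃ e, d = e + 1 := ⟨d - 1, by have := i.2; omega⟩
  rw [PMF.toMeasure_uniformOfFintype_apply _ (Set.toFinite _).measurableSet]
  have h1 : Fintype.card {b : Fin (e + 1) → Bool | b i = c} = 2 ^ e := by
    have : ({b : Fin (e + 1) → Bool | b i = c} : Set _).toFinset =
        Fintype.piFinset fun j => if j = i then {c} else Finset.univ := by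
      ext b
      simp only [Set.mem_toFinset, Set.mem_ofPred_eq, Fintype.mem_piFinset]
      constructor
      · intro h j
        split_ifs with hj
        · subst hj; simp [h]
        · simp
      · intro h
        simpa using h i
    rw [← Set.toFinset_card, this, Fintype.card_piFinset]
    have h2 : ∀ j, (if j = i then ({c} : Finset Bool) else Finset.univ).card
        = if j = i then 1 else 2 := by
      intro j; split_ifs <;> simp
    simp only [h2]
    rw [Finset.prod_ite]
    simp [Finset.filter_ne']
  rw [h1]
  simp only [Fintype.card_pi, Fintype.card_bool, Finset.prod_const, Finset.card_univ,
    Fintype.card_fin]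
  push_cast
  rw [pow_succ, ENNReal.div_eq_inv_mul, ENNReal.mul_inv (by simp) (by simp), mul_right_comm,
    ENNReal.inv_mul_cancel (by simp) (by simp), one_mul]

instance : IsProbabilityMeasure (prob d) := by
  unfold prob
  infer_instance

/-- The code determines its `n` binary digits, which are independent fair bits; values that are
never attained have probability zero. -/
theorem prob_binCode_eq_le (N : ℤ) (n : ℕ) (i : Fin d) (v : ℕ) :
    prob d {ω | binCode ω N n i = v} ≤ 2⁻¹ ^ n := by
  classical
  rcases Set.eq_empty_or_nonempty {ω : Omega d | binCode ω N n i = v} with h | ⟨ω₀, h₀⟩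
  · simp [h]
  let e : ℕ ↪ ℤ := ⟨fun l => N + l, fun a b h => by simpa using h⟩
  have hsub : {ω : Omega d | binCode ω N n i = v} ⊆
      Set.pi ((Finset.range n).map e) fun j => {b | b i = ω₀ j i} := by
    intro ω hω j hj
    simp only [Finset.coe_map, Set.mem_image, Finset.mem_coe, Finset.mem_range] at hj
    obtain ⟨l, hl, rfl⟩ := hj
    exact binCode_eq_imp (hω.trans h₀.symm) l hl
  refine (measure_mono hsub).trans ?_
  rw [prob, Measure.infinitePi_pi _ fun j _ => (Set.toFinite _).measurableSet]
  simp only [uniform_coord_eq, Finset.prod_const, Finset.card_map, Finset.card_range, le_refl]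

theorem exists_measurableSet_near_grid (i : Fin d) (t : ℝ) (N j : ℤ) :
    ∃ U : Set (Omega d), MeasurableSet U ∧
      prob d U ≤ ENNReal.ofReal (6 * min 1 ((2 : ℝ) ^ (N - j))) ∧
      ∀ ω, ∀ p : ℤ, |t - (2 ^ j * p + gridShift ω j i)| ≤ 2 ^ N → ω ∈ U := by
  rcases le_or_gt j N with hj | hj
  · refine ⟨Set.univ, MeasurableSet.univ, ?_, fun _ _ _ => Set.mem_univ _⟩
    have : (1 : ℝ) ≤ 2 ^ (N - j) := one_le_zpow₀ one_le_two (by omega)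
    rw [min_eq_left this, measure_univ, ← ENNReal.ofReal_one]
    exact ENNReal.ofReal_le_ofReal (by norm_num)
  obtain ⟨n, rfl⟩ : ∃ n : ℕ, j = N + n := ⟨(j - N).toNat, by omega⟩
  set q : ℤ := ⌊t / 2 ^ N⌋
  -- A face near `t` has position `2^N u` plus a shift in `[0, 2^N]`, where `u = 2^n p + binCode`.
  -- Closeness forces `q - 2 ≤ u ≤ q + 1`, so six candidates are more than enough, and reduction
  -- modulo `2^n` removes the unknown `p`.
  refine ⟨⋃ u ∈ Finset.Icc (q - 2) (q + 3), {ω | binCode ω N n i = (u % 2 ^ n).toNat}, ?_, ?_, ?_⟩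
  · exact Finset.measurableSet_biUnion _ fun u _ =>
      measurable_binCode N n i (measurableSet_singleton _)
  · refine (measure_biUnion_finset_le _ _).trans ?_
    refine (Finset.sum_le_sum fun u _ => prob_binCode_eq_le N n i _).trans ?_
    have h1 : (2 : ℝ) ^ (N - (N + n)) = 2⁻¹ ^ n := by
      rw [sub_add_cancel_left, zpow_neg, zpow_natCast, inv_pow]
    rw [h1, min_eq_right (pow_le_one₀ (by norm_num) (by norm_num)), Finset.sum_const, Int.card_Icc]
    have h2 : (q + 3 + 1 - (q - 2)).toNat = 6 := by omega
    rw [h2, ENNReal.ofReal_mul (by norm_num), ENNReal.ofReal_pow (by norm_num),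
      ENNReal.ofReal_inv_of_pos (by norm_num)]
    simp
  · intro ω p hp
    have h2 : (0 : ℝ) < 2 ^ N := by positivity
    rw [gridShift_add, zpow_add₀ two_ne_zero, zpow_natCast] at hp
    set a := binCode ω N n i
    have hs0 := gridShift_nonneg ω N i
    have hs1 := gridShift_le ω N i
    have hq1 : (q : ℝ) * 2 ^ N ≤ t := by
      rw [← le_div_iff₀ h2]; exact Int.floor_le _
    have hq2 : t < (q + 1) * 2 ^ N := by
      rw [← div_lt_iff₀ h2]; exact Int.lt_floor_add_one _
    rw [abs_le] at hp
    set u : ℤ := 2 ^ n * p + a with hu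
    have hup : (u : ℝ) * 2 ^ N < (q + 2) * 2 ^ N := by
      rw [hu]; push_cast; nlinarith
    have hlo : ((q : ℝ) - 2) * 2 ^ N ≤ u * 2 ^ N := by
      rw [hu]; push_cast; nlinarith
    have hup' := lt_of_mul_lt_mul_right hup h2.le
    have hlo' := le_of_mul_le_mul_right hlo h2
    have hup'' : u < q + 2 := by exact_mod_cast hup'
    have hlo'' : q - 2 ≤ u := by exact_mod_cast hlo'
    simp only [Set.mem_iUnion]
    refine ⟨u, Finset.mem_Icc.2 ⟨hlo'', by omega⟩, ?_⟩
    have ha : a < 2 ^ n := by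
      refine lt_of_le_of_lt (Finset.sum_le_sum (g := fun l => 2 ^ l) fun l _ => ?_)
        (Nat.geomSum_lt le_rfl fun k hk => Finset.mem_range.1 hk)
      split_ifs <;> simp
    have hmod : u % 2 ^ n = a := by
      rw [hu, Int.mul_add_emod_self_left]
      exact Int.emod_eq_of_lt (by positivity) (by exact_mod_cast ha)
    simp [hmod, a]

/-! ### Points, cubes and separation by the grid. -/

/-- The position of the cube of side length `2^k` that contains `x`. -/
def cubeIdx (ω : Omega d) (k : ℤ) (x : EuclideanSpace ℝ (Fin d)) : Fin d → ℤ :=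
  fun i => ⌊(x i - gridShift ω k i) / 2 ^ k⌋

theorem mem_toSet_iff (ω : Omega d) (Q : Cube d) (x : EuclideanSpace ℝ (Fin d)) :
    x ∈ Q.toSet ω ↔ cubeIdx ω Q.scale x = Q.pos := by
  have h2 : (0 : ℝ) < 2 ^ Q.scale := by positivity
  rw [funext_iff]
  refine forall_congr' fun i => ?_
  rw [cubeIdx, Int.floor_eq_iff, le_div_iff₀ h2, div_lt_iff₀ h2, Cube.side]
  constructor <;> rintro ⟨h1, h3⟩ <;> constructor <;> linarith

/-- Nestedness of the grid in arithmetic form: the coarse index is a function of the fine one. -/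
theorem cubeIdx_add (ω : Omega d) (k : ℤ) (n : ℕ) (x : EuclideanSpace ℝ (Fin d)) (i : Fin d) :
    cubeIdx ω (k + n) x i = (cubeIdx ω k x i - binCode ω k n i) / 2 ^ n := by
  have h2 : (0 : ℝ) < 2 ^ k := by positivity
  have : (x i - gridShift ω (k + n) i) / 2 ^ (k + n : ℤ) =
      ((x i - gridShift ω k i) / 2 ^ k - (binCode ω k n i : ℕ)) / ((2 ^ n : ℕ) : ℝ) := by
    rw [gridShift_add, zpow_add₀ two_ne_zero, zpow_natCast]
    field_simp
    push_cast
    ring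
  rw [cubeIdx, this, Int.floor_div_natCast, Int.floor_sub_natCast]
  simp [cubeIdx]

theorem cubeIdx_eq_of_le {ω : Omega d} {j k : ℤ} (hjk : j ≤ k) {x x' : EuclideanSpace ℝ (Fin d)}
    (h : cubeIdx ω j x = cubeIdx ω j x') : cubeIdx ω k x = cubeIdx ω k x' := by
  obtain ⟨n, rfl⟩ : ∃ n : ℕ, k = j + n := ⟨(k - j).toNat, by omega⟩
  funext i
  rw [cubeIdx_add, cubeIdx_add, h]

theorem abs_apply_le_norm (x : EuclideanSpace ℝ (Fin d)) (i : Fin d) : |x i| ≤ ‖x‖ :=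
  PiLp.norm_apply_le x i

/-- Points within `2^N` of `x` are in the same cube of side length `2^j` as `x`, off an event of
small probability. -/
theorem exists_measurableSet_separating (x : EuclideanSpace ℝ (Fin d)) (N j : ℤ) :
    ∃ U : Set (Omega d), MeasurableSet U ∧
      prob d U ≤ ENNReal.ofReal (6 * d * min 1 ((2 : ℝ) ^ (N - j))) ∧
      ∀ ω, ω ∉ U → ∀ x', ‖x - x'‖ ≤ 2 ^ N → cubeIdx ω j x = cubeIdx ω j x' := by
  choose U hUm hUp hU using fun i => exists_measurableSet_near_grid i (x i) N j
  refine ⟨⋃ i, U i, MeasurableSet.iUnion hUm, ?_, ?_⟩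
  · refine (measure_iUnion_fintype_le _ _).trans ((Finset.sum_le_sum fun i _ => hUp i).trans ?_)
    rw [Finset.sum_const, Finset.card_univ, Fintype.card_fin, nsmul_eq_mul, mul_comm (6 : ℝ) d,
      mul_assoc, ENNReal.ofReal_mul (Nat.cast_nonneg d)]
    simp
  · intro ω hω x' hx'
    by_contra hne
    obtain ⟨i, hi⟩ := Function.ne_iff.1 hne
    apply hω
    have hxi : |x i - x' i| ≤ 2 ^ N := (abs_apply_le_norm (x - x') i).trans hx'
    have h2 : (0 : ℝ) < 2 ^ j := by positivity
    -- The lower face of the cube with the larger index lies between `x i` and `x' i`, hence within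
    -- `2^N` of `x i`.
    refine Set.mem_iUnion.2 ⟨i, hU i ω (max (cubeIdx ω j x i) (cubeIdx ω j x' i)) ?_⟩
    have bd : ∀ z : EuclideanSpace ℝ (Fin d), 2 ^ j * (cubeIdx ω j z i : ℝ) + gridShift ω j i ≤ z i ∧
        z i < 2 ^ j * ((cubeIdx ω j z i : ℝ) + 1) + gridShift ω j i :=
      fun z => (mem_toSet_iff ω ⟨j, cubeIdx ω j z⟩ z).2 rfl i
    obtain ⟨a1, a2⟩ := bd x
    obtain ⟨b1, b2⟩ := bd x'
    rw [abs_le] at hxi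
    rcases lt_or_gt_of_ne hi with h | h
    · rw [max_eq_right h.le]
      have h' : (cubeIdx ω j x i : ℝ) + 1 ≤ cubeIdx ω j x' i := by exact_mod_cast h
      have := mul_le_mul_of_nonneg_left h' h2.le
      rw [abs_le]; constructor <;> linarith
    · rw [max_eq_left h.le]
      have h' : (cubeIdx ω j x' i : ℝ) + 1 ≤ cubeIdx ω j x i := by exact_mod_cast h
      have := mul_le_mul_of_nonneg_left h' h2.le
      rw [abs_le]; constructor <;> linarith

/-- Adding up the coordinates gives `d` instead of the sharp `√d`; this is the `d` in `cutoff`. -/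
theorem norm_sub_le_of_cubeIdx_eq {ω : Omega d} {k : ℤ} {x y : EuclideanSpace ℝ (Fin d)}
    (h : cubeIdx ω k x = cubeIdx ω k y) : ‖x - y‖ ≤ d * 2 ^ k := by
  have hi : ∀ i, ‖(x - y) i‖ ≤ 2 ^ k := by
    intro i
    obtain ⟨a1, a2⟩ := (mem_toSet_iff ω ⟨k, cubeIdx ω k x⟩ x).2 rfl i
    obtain ⟨b1, b2⟩ := (mem_toSet_iff ω ⟨k, cubeIdx ω k x⟩ y).2 h.symm i
    simp only [Cube.side] at a1 a2 b1 b2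
    rw [Real.norm_eq_abs, PiLp.sub_apply, abs_le]
    constructor <;> linarith
  calc ‖x - y‖ = ‖∑ i, EuclideanSpace.single i ((x - y) i)‖ := by
        congr 1
        ext j
        simp
    _ ≤ ∑ i, ‖EuclideanSpace.single i ((x - y) i)‖ := norm_sum_le _ _
    _ ≤ ∑ _i : Fin d, (2 : ℝ) ^ k := by
        refine Finset.sum_le_sum fun i _ => ?_
        simpa using hi i
    _ = d * 2 ^ k := by simp

theorem measurable_cubeIdx (ω : Omega d) (k : ℤ) : Measurable (cubeIdx ω k) := by
  unfold cubeIdx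
  refine measurable_pi_lambda _ fun i => Int.measurable_floor.comp ?_
  fun_prop

theorem measurableSet_toSet (ω : Omega d) (Q : Cube d) : MeasurableSet (Q.toSet ω) := by
  have : Q.toSet ω = cubeIdx ω Q.scale ⁻¹' {Q.pos} := by
    ext x
    exact mem_toSet_iff ω Q x
  rw [this]
  exact measurable_cubeIdx ω _ (measurableSet_singleton _)

theorem mem_descendants {ω : Omega d} {m : ℕ} {Q R : Cube d} :
    R ∈ descendants ω m Q ↔ R.scale = Q.scale - m ∧ R.toSet ω ⊆ Q.toSet ω := by
  simp [descendants]

/-! ### Haar functions and the kernel of a single scale. -/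

namespace IsHaarFunction

variable {ω : Omega d} {Q : Cube d} {h : EuclideanSpace ℝ (Fin d) → ℝ}

theorem eq_zero (hh : IsHaarFunction ω Q h) {x : EuclideanSpace ℝ (Fin d)}
    (hx : x ∉ Q.toSet ω) : h x = 0 := by
  obtain ⟨c, hc⟩ := hh
  rw [hc]
  refine Finset.sum_eq_zero fun R hR => ?_
  rw [Set.indicator_of_notMem fun hxR => hx ((mem_descendants.1 hR).2 hxR), mul_zero]

theorem eq_of_cubeIdx_eq (hh : IsHaarFunction ω Q h) {x x' : EuclideanSpace ℝ (Fin d)}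
    (hx : cubeIdx ω (Q.scale - 1) x = cubeIdx ω (Q.scale - 1) x') : h x = h x' := by
  classical
  obtain ⟨c, hc⟩ := hh
  rw [hc, hc]
  refine Finset.sum_congr rfl fun R hR => ?_
  have hs : R.scale = Q.scale - 1 := by simpa using (mem_descendants.1 hR).1
  have : x ∈ R.toSet ω ↔ x' ∈ R.toSet ω := by
    rw [mem_toSet_iff, mem_toSet_iff, hs, hx]
  simp only [Set.indicator_apply, this, Pi.one_apply]

theorem measurable (hh : IsHaarFunction ω Q h) : Measurable h := by
  obtain ⟨c, hc⟩ := hh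
  rw [funext hc]
  exact Finset.measurable_fun_sum _ fun R _ =>
    (measurable_one.indicator (measurableSet_toSet ω R)).const_mul _

theorem exists_bound (hh : IsHaarFunction ω Q h) : ∃ B, ∀ x, ‖h x‖ ≤ B := by
  classical
  obtain ⟨c, hc⟩ := hh
  refine ⟨∑ R ∈ descendants ω 1 Q, |c R|, fun x => ?_⟩
  rw [hc]
  refine (norm_sum_le _ _).trans (Finset.sum_le_sum fun R _ => ?_)
  rw [norm_mul, Real.norm_eq_abs]
  refine mul_le_of_le_one_right (abs_nonneg _) ?_
  rw [Set.indicator_apply]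
  split_ifs <;> simp

end IsHaarFunction

theorem abs_sum_le_one_of_eq_zero {ι : Type*} (s : Finset ι) (u : ι → ℝ) (a : ι)
    (h0 : ∀ b ∈ s, b ≠ a → u b = 0) (ha : a ∈ s → |u a| ≤ 1) : |∑ b ∈ s, u b| ≤ 1 := by
  by_cases h : a ∈ s
  · rw [Finset.sum_eq_single_of_mem a h h0]
    exact ha h
  · rw [Finset.sum_eq_zero fun b hb => h0 b hb fun e => h (e ▸ hb)]
    simp

theorem measurable_comp_countable {ι α : Type*} [Countable ι] [MeasurableSpace ι]
    [MeasurableSingletonClass ι] [MeasurableSpace α] {F : ι → α → ℝ} (hF : ∀ i, Measurable (F i))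
    {e : α → ι} (he : Measurable e) : Measurable fun z => F (e z) z :=
  (measurable_from_prod_countable_right (f := fun q : ι × α => F q.1 q.2) hF).comp
    (he.prodMk measurable_id)

/-- The conditions on the Haar functions of a Haar shift. -/
def IsShiftData (ω : Omega d) (m n : ℕ)
    (hin hout : Cube d → Cube d → EuclideanSpace ℝ (Fin d) → ℝ) : Prop :=
  ∀ Q : Cube d, ∀ Q' ∈ descendants ω m Q, ∀ Q'' ∈ descendants ω n Q,
    IsHaarFunction ω Q'' (hin Q' Q'') ∧ IsHaarFunction ω Q' (hout Q' Q'') ∧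
    ∀ x y, |hin Q' Q'' y * hout Q' Q'' x| ≤ 1

/-- The kernel of the part of a Haar shift that belongs to the cubes of side length `2^k`. -/
def scaleKernel (ω : Omega d) (m n : ℕ)
    (hin hout : Cube d → Cube d → EuclideanSpace ℝ (Fin d) → ℝ) (k : ℤ)
    (x y : EuclideanSpace ℝ (Fin d)) : ℝ :=
  (1 / ((2 : ℝ) ^ k) ^ d) *
    ∑ Q' ∈ descendants ω m ⟨k, cubeIdx ω k x⟩, ∑ Q'' ∈ descendants ω n ⟨k, cubeIdx ω k x⟩,
      hin Q' Q'' y * hout Q' Q'' x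

/-- The size of a kernel at scale `2^k`, at points at distance `ρ`. -/
def cutoff (d : ℕ) (ρ : ℝ) (k : ℤ) : ℝ := if ρ ≤ d * 2 ^ k then 1 / ((2 : ℝ) ^ k) ^ d else 0

theorem cutoff_nonneg (ρ : ℝ) (k : ℤ) : 0 ≤ cutoff d ρ k := by
  unfold cutoff
  positivity

theorem cutoff_anti {ρ ρ' : ℝ} (h : ρ ≤ ρ') (k : ℤ) : cutoff d ρ' k ≤ cutoff d ρ k := by
  unfold cutoff
  split_ifs with h1 h2
  · exact le_rfl
  · exact absurd (h.trans h1) h2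
  · positivity
  · exact le_rfl

section Data

variable {ω : Omega d} {m n : ℕ} {hin hout : Cube d → Cube d → EuclideanSpace ℝ (Fin d) → ℝ}

/-- Only the `Q'` containing `x` and the `Q''` containing `y` contribute, so the double sum has at
most one nonzero term. If `x` and `y` lie in different cubes of side `2^k`, there is none. -/
theorem abs_scaleKernel_le (H : IsShiftData ω m n hin hout) (k : ℤ)
    (x y : EuclideanSpace ℝ (Fin d)) :
    |scaleKernel ω m n hin hout k x y| ≤ cutoff d ‖x - y‖ k := by
  by_cases hxy : cubeIdx ω k x = cubeIdx ω k y
  · rw [cutoff, if_pos (norm_sub_le_of_cubeIdx_eq hxy), scaleKernel, abs_mul,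
      abs_of_nonneg (by positivity)]
    refine mul_le_of_le_one_right (by positivity) ?_
    refine abs_sum_le_one_of_eq_zero _ _ ⟨k - m, cubeIdx ω (k - m) x⟩ ?_ ?_
    · intro Q' hQ' hne
      refine Finset.sum_eq_zero fun Q'' hQ'' => ?_
      rw [(H _ Q' hQ' Q'' hQ'').2.1.eq_zero, mul_zero]
      intro hx
      refine hne (Cube.ext (mem_descendants.1 hQ').1 ?_)
      rw [mem_toSet_iff, (mem_descendants.1 hQ').1] at hx
      exact hx.symm
    · intro hQ'
      refine abs_sum_le_one_of_eq_zero _ _ ⟨k - n, cubeIdx ω (k - n) y⟩ ?_ ?_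
      · intro Q'' hQ'' hne
        rw [(H _ _ hQ' Q'' hQ'').1.eq_zero, zero_mul]
        intro hx
        refine hne (Cube.ext (mem_descendants.1 hQ'').1 ?_)
        rw [mem_toSet_iff, (mem_descendants.1 hQ'').1] at hx
        exact hx.symm
      · intro hQ''
        exact (H _ _ hQ' _ hQ'').2.2 x y
  · have : scaleKernel ω m n hin hout k x y = 0 := by
      rw [scaleKernel, Finset.sum_eq_zero, mul_zero]
      intro Q' hQ'
      refine Finset.sum_eq_zero fun Q'' hQ'' => ?_
      rw [(H _ _ hQ' Q'' hQ'').1.eq_zero, zero_mul]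
      intro hy
      have := (mem_toSet_iff _ _ _).1 ((mem_descendants.1 hQ'').2 hy)
      exact hxy this.symm
    rw [this, abs_zero]
    exact cutoff_nonneg _ _

/-- A Haar function on `Q'` is constant on the children of `Q'`, which have side `2^{k-m-1}`; by
nestedness such a cube also fixes the top cube. -/
theorem scaleKernel_eq_left (H : IsShiftData ω m n hin hout) {k : ℤ}
    {x x' : EuclideanSpace ℝ (Fin d)} (y : EuclideanSpace ℝ (Fin d))
    (h : cubeIdx ω (k - m - 1) x = cubeIdx ω (k - m - 1) x') :
    scaleKernel ω m n hin hout k x y = scaleKernel ω m n hin hout k x' y := by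
  have hk : cubeIdx ω k x = cubeIdx ω k x' := cubeIdx_eq_of_le (by omega) h
  rw [scaleKernel, scaleKernel, hk]
  congr 1
  refine Finset.sum_congr rfl fun Q' hQ' => Finset.sum_congr rfl fun Q'' hQ'' => ?_
  congr 1
  refine (H _ _ hQ' Q'' hQ'').2.1.eq_of_cubeIdx_eq ?_
  rw [(mem_descendants.1 hQ').1]
  exact h

theorem scaleKernel_eq_right (H : IsShiftData ω m n hin hout) {k : ℤ}
    (x : EuclideanSpace ℝ (Fin d)) {y y' : EuclideanSpace ℝ (Fin d)}
    (h : cubeIdx ω (k - n - 1) y = cubeIdx ω (k - n - 1) y') :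
    scaleKernel ω m n hin hout k x y = scaleKernel ω m n hin hout k x y' := by
  rw [scaleKernel, scaleKernel]
  congr 1
  refine Finset.sum_congr rfl fun Q' hQ' => Finset.sum_congr rfl fun Q'' hQ'' => ?_
  congr 1
  refine (H _ _ hQ' Q'' hQ'').1.eq_of_cubeIdx_eq ?_
  rw [(mem_descendants.1 hQ'').1]
  exact h

theorem measurable_scaleKernel (H : IsShiftData ω m n hin hout) (k : ℤ) :
    Measurable fun z : EuclideanSpace ℝ (Fin d) × EuclideanSpace ℝ (Fin d) =>
      scaleKernel ω m n hin hout k z.1 z.2 := by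
  have hG : ∀ p : Fin d → ℤ,
      Measurable fun z : EuclideanSpace ℝ (Fin d) × EuclideanSpace ℝ (Fin d) =>
      (1 / ((2 : ℝ) ^ k) ^ d) *
        ∑ Q' ∈ descendants ω m ⟨k, p⟩, ∑ Q'' ∈ descendants ω n ⟨k, p⟩,
          hin Q' Q'' z.2 * hout Q' Q'' z.1 := by
    intro p
    refine Measurable.const_mul (Finset.measurable_fun_sum _ fun Q' hQ' => ?_) _
    refine Finset.measurable_fun_sum _ fun Q'' hQ'' => ?_
    exact ((H _ _ hQ' Q'' hQ'').1.measurable.comp measurable_snd).mul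
      ((H _ _ hQ' Q'' hQ'').2.1.measurable.comp measurable_fst)
  have h := measurable_comp_countable hG ((measurable_cubeIdx ω k).comp measurable_fst)
  simp only [scaleKernel]
  exact h

theorem scalePart_eq_integral (H : IsShiftData ω m n hin hout) (k : ℤ)
    {f : EuclideanSpace ℝ (Fin d) → ℝ} (hf : Integrable f) (x : EuclideanSpace ℝ (Fin d)) :
    scalePart ω m n hin hout k f x = ∫ y, f y * scaleKernel ω m n hin hout k x y := by
  rw [scalePart, tsum_eq_single (cubeIdx ω k x)]
  · have hi : ∀ Q' ∈ descendants ω m ⟨k, cubeIdx ω k x⟩,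
        ∀ Q'' ∈ descendants ω n ⟨k, cubeIdx ω k x⟩,
        Integrable fun y => f y * hin Q' Q'' y * hout Q' Q'' x := by
      intro Q' hQ' Q'' hQ''
      obtain ⟨B, hB⟩ := (H _ _ hQ' Q'' hQ'').1.exists_bound
      exact (hf.mul_bdd (c := B) (H _ _ hQ' Q'' hQ'').1.measurable.aestronglyMeasurable
        (Eventually.of_forall hB)).mul_const _
    have e : ∀ y, f y * scaleKernel ω m n hin hout k x y = (1 / ((2 : ℝ) ^ k) ^ d) *
        ∑ Q' ∈ descendants ω m ⟨k, cubeIdx ω k x⟩, ∑ Q'' ∈ descendants ω n ⟨k, cubeIdx ω k x⟩,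
          f y * hin Q' Q'' y * hout Q' Q'' x := by
      intro y
      rw [scaleKernel, mul_left_comm, Finset.mul_sum]
      simp only [Finset.mul_sum, mul_assoc]
    simp only [e]
    rw [integral_const_mul, integral_finsetSum _ fun Q' hQ' =>
      integrable_finsetSum _ fun Q'' hQ'' => hi Q' hQ' Q'' hQ'']
    rw [Cube.side]
    congr 1
    refine Finset.sum_congr rfl fun Q' hQ' => ?_
    rw [integral_finsetSum _ fun Q'' hQ'' => hi Q' hQ' Q'' hQ'']
    refine Finset.sum_congr rfl fun Q'' hQ'' => ?_
    rw [integral_mul_const]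
  · intro p hp
    rw [Finset.sum_eq_zero, mul_zero]
    intro Q' hQ'
    refine Finset.sum_eq_zero fun Q'' hQ'' => ?_
    rw [(H _ _ hQ' Q'' hQ'').2.1.eq_zero, mul_zero]
    intro hx
    exact hp ((mem_toSet_iff _ _ _).1 ((mem_descendants.1 hQ').2 hx)).symm

theorem abs_scaleKernel_le_const (H : IsShiftData ω m n hin hout) (k : ℤ)
    (x y : EuclideanSpace ℝ (Fin d)) :
    |scaleKernel ω m n hin hout k x y| ≤ 1 / ((2 : ℝ) ^ k) ^ d := by
  refine (abs_scaleKernel_le H k x y).trans ?_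
  rw [cutoff]
  split_ifs
  · exact le_rfl
  · positivity

theorem integrable_mul_scaleKernel (H : IsShiftData ω m n hin hout) (k : ℤ)
    {w : EuclideanSpace ℝ (Fin d) × EuclideanSpace ℝ (Fin d) → ℝ}
    (hw : Integrable w (volume.prod volume)) :
    Integrable (fun z => w z * scaleKernel ω m n hin hout k z.1 z.2) (volume.prod volume) :=
  hw.mul_bdd (c := 1 / ((2 : ℝ) ^ k) ^ d) (measurable_scaleKernel H k).aestronglyMeasurable
    (Eventually.of_forall fun z => abs_scaleKernel_le_const H k z.1 z.2)

theorem integral_scalePart_mul (H : IsShiftData ω m n hin hout) (k : ℤ)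
    {f g : EuclideanSpace ℝ (Fin d) → ℝ} (hf : Integrable f) (hg : Integrable g) :
    Integrable (fun x => scalePart ω m n hin hout k f x * g x) ∧
    ∫ x, scalePart ω m n hin hout k f x * g x =
      ∫ z : EuclideanSpace ℝ (Fin d) × EuclideanSpace ℝ (Fin d),
        f z.2 * g z.1 * scaleKernel ω m n hin hout k z.1 z.2 ∂(volume.prod volume) := by
  have hw : Integrable (fun z : EuclideanSpace ℝ (Fin d) × EuclideanSpace ℝ (Fin d) =>
      f z.2 * g z.1) (volume.prod volume) := by
    simpa only [mul_comm] using hg.mul_prod hf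
  have hi := integrable_mul_scaleKernel H k hw
  have e : ∀ x, scalePart ω m n hin hout k f x * g x =
      ∫ y, f y * g x * scaleKernel ω m n hin hout k x y := by
    intro x
    rw [scalePart_eq_integral H k hf, ← integral_mul_const]
    congr 1
    funext y
    ring
  simp only [e]
  exact ⟨hi.integral_prod_left, (integral_prod _ hi).symm⟩

end Data

/-! ### Geometric sums over complexities and scales. -/

theorem tsum_prod_eq {α β : Type*} (f : α × β → ℝ≥0∞) :
    ∑' p, f p = ∑' (a) (b), f (a, b) :=
  ENNReal.tsum_prod (f := fun a b => f (a, b))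

/-- The sum of a geometric series with ratio `2^{-a}`. -/
def geomConst (a : ℝ) : ℝ≥0∞ := ∑' l : ℕ, ENNReal.ofReal ((2 : ℝ) ^ (-((l : ℝ) * a)))

theorem summable_two_rpow {a : ℝ} (ha : 0 < a) :
    Summable fun l : ℕ => (2 : ℝ) ^ (-((l : ℝ) * a)) := by
  have h : ∀ l : ℕ, (2 : ℝ) ^ (-((l : ℝ) * a)) = ((2 : ℝ) ^ (-a)) ^ l := by
    intro l
    rw [← Real.rpow_mul_natCast zero_le_two]
    congr 1
    ring
  simp only [h]
  exact summable_geometric_of_lt_one (by positivity)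
    (Real.rpow_lt_one_of_one_lt_of_neg one_lt_two (neg_lt_zero.2 ha))

theorem geomConst_ne_top {a : ℝ} (ha : 0 < a) : geomConst a ≠ ∞ :=
  (summable_two_rpow ha).tsum_ofReal_ne_top

/-- The sum over all dyadic `u` of `min 1 u * u^{-δ}`. -/
def crossConst (δ : ℝ) : ℝ≥0∞ :=
  ∑' l : ℤ, ENNReal.ofReal (min 1 ((2 : ℝ) ^ l) * (2 : ℝ) ^ (-((l : ℝ) * δ)))

/-- The terms decay like `2^{-lδ}` for `l ≥ 0`, by `0 < δ`, and like `2^{l(1-δ)}` for `l < 0`, by `δ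
< 1`. -/
theorem crossConst_ne_top {δ : ℝ} (hδ0 : 0 < δ) (hδ1 : δ < 1) : crossConst δ ≠ ∞ := by
  refine Summable.tsum_ofReal_ne_top (Summable.of_nat_of_neg ?_ ?_)
  · refine Summable.of_nonneg_of_le (fun l => by positivity) (fun l => ?_)
      (summable_two_rpow hδ0)
    push_cast
    exact mul_le_of_le_one_left (by positivity) (min_le_left _ _)
  · refine Summable.of_nonneg_of_le (fun l => by positivity) (fun l => ?_)
      (summable_two_rpow (sub_pos.2 hδ1))
    calc _ ≤ (2 : ℝ) ^ (-(l : ℤ)) * (2 : ℝ) ^ (-(((-(l : ℤ) : ℤ) : ℝ) * δ)) := by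
          gcongr
          exact min_le_right _ _
      _ = _ := by
          rw [← Real.rpow_intCast, ← Real.rpow_add two_pos]
          congr 1
          push_cast
          ring

/-- Substitute `l = a + m` and enlarge the range of `l` to all integers, which makes the constant
independent of `a`. -/
theorem tsum_min_mul_le (δ : ℝ) (a : ℤ) :
    ∑' m : ℕ, ENNReal.ofReal ((2 : ℝ) ^ (-((m : ℝ) * δ)) * min 1 ((2 : ℝ) ^ (a + m))) ≤
      ENNReal.ofReal ((2 : ℝ) ^ ((a : ℝ) * δ)) * crossConst δ := by
  have h : ∀ m : ℕ, (2 : ℝ) ^ (-((m : ℝ) * δ)) * min 1 ((2 : ℝ) ^ (a + m)) =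
      (2 : ℝ) ^ ((a : ℝ) * δ) *
        (min 1 ((2 : ℝ) ^ (a + m)) * (2 : ℝ) ^ (-(((a + m : ℤ) : ℝ) * δ))) := by
    intro m
    rw [mul_left_comm, ← Real.rpow_add two_pos, mul_comm]
    congr 2
    push_cast
    ring
  simp only [h, ENNReal.ofReal_mul (show (0 : ℝ) ≤ (2 : ℝ) ^ ((a : ℝ) * δ) by positivity)]
  rw [ENNReal.tsum_mul_left]
  gcongr
  exact ENNReal.tsum_comp_le_tsum_of_injective (f := fun m : ℕ => a + (m : ℤ))
    (fun b c hbc => by simpa using hbc)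
    (fun l : ℤ => ENNReal.ofReal (min 1 ((2 : ℝ) ^ l) * (2 : ℝ) ^ (-((l : ℝ) * δ))))

theorem cutoff_eq_rpow {ρ : ℝ} {k : ℤ} (h : ρ ≤ d * 2 ^ k) :
    cutoff d ρ k = (2 : ℝ) ^ (-((k : ℝ) * d)) := by
  rw [cutoff, if_pos h, ← Real.rpow_intCast, ← Real.rpow_mul_natCast zero_le_two,
    Real.rpow_neg zero_le_two, one_div]

/-- With `2^k₀ < ρ / d ≤ 2^(k₀+1)`, all terms with `k ≤ k₀` vanish and the rest is a geometric tail.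
The case `b = 0` serves the size estimate and `b = δ` the smoothness estimate. -/
theorem tsum_cutoff_le (hd : 1 ≤ d) {b : ℝ} (hb : 0 ≤ b) {ρ : ℝ} (hρ : 0 < ρ) :
    ∑' k : ℤ, ENNReal.ofReal (cutoff d ρ k * (2 : ℝ) ^ (-((k : ℝ) * b))) ≤
      ENNReal.ofReal ((d / ρ) ^ (b + d)) * geomConst (b + d) := by
  have hd0 : (0 : ℝ) < d := by exact_mod_cast hd
  obtain ⟨k₀, h1, h2⟩ := exists_mem_Ioc_zpow (div_pos hρ hd0) (one_lt_two : (1 : ℝ) < 2)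
  have hinj : Function.Injective fun l : ℕ => k₀ + 1 + (l : ℤ) :=
    fun b c hbc => by simpa using hbc
  rw [← hinj.tsum_eq, geomConst, ← ENNReal.tsum_mul_left]
  · refine ENNReal.tsum_le_tsum fun l => ?_
    rw [← ENNReal.ofReal_mul (by positivity)]
    refine ENNReal.ofReal_le_ofReal ?_
    have e1 : ((d : ℝ) / ρ) ^ (b + d) ≥ (2 : ℝ) ^ (-(((k₀ + 1 : ℤ) : ℝ) * (b + d))) := by
      have : ((d : ℝ) / ρ) = (ρ / d)⁻¹ := by rw [inv_div]
      rw [this, Real.inv_rpow (by positivity), Real.rpow_neg zero_le_two, Real.rpow_mul zero_le_two,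
        Real.rpow_intCast]
      gcongr
    by_cases hk : ρ ≤ d * 2 ^ (k₀ + 1 + (l : ℤ))
    · rw [cutoff_eq_rpow hk]
      calc _ = (2 : ℝ) ^ (-(((k₀ + 1 : ℤ) : ℝ) * (b + d))) * (2 : ℝ) ^ (-((l : ℝ) * (b + d))) := by
            rw [← Real.rpow_add two_pos, ← Real.rpow_add two_pos]
            congr 1
            push_cast
            ring
        _ ≤ _ := by gcongr
    · rw [cutoff, if_neg hk, zero_mul]
      positivity
  · intro k hk
    have hk' : ρ ≤ d * 2 ^ k := by
      by_contra hcon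
      simp [cutoff, hcon] at hk
    have h3 : (2 : ℝ) ^ k₀ < 2 ^ k := by
      refine h1.trans_le ?_
      rw [div_le_iff₀ hd0]
      linarith
    have h4 := (zpow_lt_zpow_iff_right₀ (one_lt_two : (1 : ℝ) < 2)).1 h3
    exact ⟨(k - (k₀ + 1)).toNat, by simp only; omega⟩

/-- The decay of the coefficients in the complexity. -/
def weight (δ : ℝ) (p : ℕ × ℕ) : ℝ := (2 : ℝ) ^ (-(((p.1 : ℝ) + p.2) * δ))

theorem weight_pos (δ : ℝ) (p : ℕ × ℕ) : 0 < weight δ p := by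
  unfold weight
  positivity

theorem weight_eq (δ : ℝ) (m n : ℕ) :
    weight δ (m, n) = (2 : ℝ) ^ (-((m : ℝ) * δ)) * (2 : ℝ) ^ (-((n : ℝ) * δ)) := by
  rw [weight, ← Real.rpow_add two_pos]
  congr 1
  ring

theorem tsum_weight (δ : ℝ) :
    ∑' p : ℕ × ℕ, ENNReal.ofReal (weight δ p) = geomConst δ * geomConst δ := by
  rw [tsum_prod_eq]
  simp only [weight_eq]
  have h : ∀ m n : ℕ, ENNReal.ofReal ((2 : ℝ) ^ (-((m : ℝ) * δ)) * (2 : ℝ) ^ (-((n : ℝ) * δ))) =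
      ENNReal.ofReal ((2 : ℝ) ^ (-((m : ℝ) * δ))) * ENNReal.ofReal ((2 : ℝ) ^ (-((n : ℝ) * δ))) :=
    fun m n => ENNReal.ofReal_mul (by positivity)
  simp only [h, ENNReal.tsum_mul_left, ENNReal.tsum_mul_right, geomConst]

theorem summable_weight {δ : ℝ} (hδ : 0 < δ) : Summable (weight δ) := by
  have h : ∑' p : ℕ × ℕ, ENNReal.ofReal (weight δ p) ≠ ∞ := by
    rw [tsum_weight]
    exact ENNReal.mul_ne_top (geomConst_ne_top hδ) (geomConst_ne_top hδ)
  simpa only [ENNReal.toReal_ofReal (weight_pos δ _).le] using ENNReal.summable_toReal h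

theorem tsum_weight_mul_cutoff_le (hd : 1 ≤ d) (δ : ℝ) {ρ : ℝ} (hρ : 0 < ρ) :
    ∑' q : (ℕ × ℕ) × ℤ, ENNReal.ofReal (weight δ q.1 * cutoff d ρ q.2) ≤
      geomConst δ * geomConst δ * (ENNReal.ofReal ((d / ρ) ^ d) * geomConst d) := by
  have h := tsum_cutoff_le hd le_rfl hρ
  simp only [mul_zero, neg_zero, Real.rpow_zero, mul_one, zero_add, Real.rpow_natCast] at h
  rw [tsum_prod_eq]
  simp only [ENNReal.ofReal_mul (weight_pos δ _).le, ENNReal.tsum_mul_left, ENNReal.tsum_mul_right,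
    tsum_weight]
  gcongr

/-- Here `min` bounds, up to a constant, the probability that the grid of side `2^{k-m-1}` separates
points at distance `2^N`. Summing over `m` first produces `2^{(N+1-k)δ}`, and this extra decay in
`k` turns `ρ^{-d}` into `ρ^{-(δ+d)}`. -/
theorem tsum_weight_mul_cutoff_mul_min_le (hd : 1 ≤ d) {δ : ℝ} (hδ0 : 0 < δ) {ρ : ℝ} (hρ : 0 < ρ)
    (N : ℤ) :
    ∑' q : (ℕ × ℕ) × ℤ, ENNReal.ofReal
        (weight δ q.1 * cutoff d ρ q.2 * min 1 ((2 : ℝ) ^ (N - (q.2 - q.1.1 - 1)))) ≤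
      geomConst δ * crossConst δ * geomConst (δ + d) *
        ENNReal.ofReal ((2 : ℝ) ^ (((N : ℝ) + 1) * δ) * (d / ρ) ^ (δ + d)) := by
  have hterm : ∀ (m n : ℕ) (k : ℤ), ENNReal.ofReal
      (weight δ (m, n) * cutoff d ρ k * min 1 ((2 : ℝ) ^ (N - (k - m - 1)))) =
      ENNReal.ofReal (cutoff d ρ k) * (ENNReal.ofReal ((2 : ℝ) ^ (-((m : ℝ) * δ)) *
        min 1 ((2 : ℝ) ^ ((N + 1 - k) + m))) * ENNReal.ofReal ((2 : ℝ) ^ (-((n : ℝ) * δ)))) := by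
    intro m n k
    rw [← ENNReal.ofReal_mul (by positivity), ← ENNReal.ofReal_mul (cutoff_nonneg _ _), weight_eq]
    have : N - (k - m - 1) = (N + 1 - k) + m := by ring
    rw [this]
    congr 1
    ring
  rw [tsum_prod_eq, ENNReal.tsum_comm]
  simp only [tsum_prod_eq]
  simp only [hterm, ENNReal.tsum_mul_left, ENNReal.tsum_mul_right]
  calc _ ≤ ∑' k : ℤ, ENNReal.ofReal (cutoff d ρ k) *
        ((ENNReal.ofReal ((2 : ℝ) ^ (((N + 1 - k : ℤ) : ℝ) * δ)) * crossConst δ) *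
          geomConst δ) := by
        refine ENNReal.tsum_le_tsum fun k => ?_
        gcongr
        · exact tsum_min_mul_le δ _
        · exact le_rfl
    _ = ∑' k : ℤ, (geomConst δ * crossConst δ * ENNReal.ofReal ((2 : ℝ) ^ (((N : ℝ) + 1) * δ))) *
          ENNReal.ofReal (cutoff d ρ k * (2 : ℝ) ^ (-((k : ℝ) * δ))) := by
        refine tsum_congr fun k => ?_
        have : (2 : ℝ) ^ (((N + 1 - k : ℤ) : ℝ) * δ) =
            (2 : ℝ) ^ (((N : ℝ) + 1) * δ) * (2 : ℝ) ^ (-((k : ℝ) * δ)) := by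
          rw [← Real.rpow_add two_pos]
          congr 1
          push_cast
          ring
        rw [this, ENNReal.ofReal_mul (by positivity), ENNReal.ofReal_mul (cutoff_nonneg _ _)]
        ring
    _ ≤ _ := by
        rw [ENNReal.tsum_mul_left, ENNReal.ofReal_mul (by positivity)]
        refine (mul_le_mul_right (tsum_cutoff_le hd hδ0.le hρ) _).trans (le_of_eq ?_)
        ring

/-! ### Weighted kernel families and their mean oscillation. -/

/-- The properties of the kernels `λ_{m,n} s_k^{m,n}`, indexed by `((m, n), k)`, that are common to
all weighted families of Haar shifts on `𝒟_ω`. -/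
structure IsKernelFamily (δ : ℝ) (ω : Omega d)
    (t : (ℕ × ℕ) × ℤ → EuclideanSpace ℝ (Fin d) → EuclideanSpace ℝ (Fin d) → ℝ) : Prop where
  bound : ∀ q x y, |t q x y| ≤ weight δ q.1 * cutoff d ‖x - y‖ q.2
  left : ∀ (q : (ℕ × ℕ) × ℤ) (x x' y : EuclideanSpace ℝ (Fin d)),
    cubeIdx ω (q.2 - q.1.1 - 1) x = cubeIdx ω (q.2 - q.1.1 - 1) x' → t q x y = t q x' y
  right : ∀ (q : (ℕ × ℕ) × ℤ) (x y y' : EuclideanSpace ℝ (Fin d)),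
    cubeIdx ω (q.2 - q.1.2 - 1) y = cubeIdx ω (q.2 - q.1.2 - 1) y' → t q x y = t q x y'
  measurable : ∀ q, Measurable fun z : EuclideanSpace ℝ (Fin d) × EuclideanSpace ℝ (Fin d) =>
    t q z.1 z.2

namespace IsKernelFamily

variable {δ : ℝ} {ω : Omega d}
  {t : (ℕ × ℕ) × ℤ → EuclideanSpace ℝ (Fin d) → EuclideanSpace ℝ (Fin d) → ℝ}

theorem enorm_le (ht : IsKernelFamily δ ω t) (q : (ℕ × ℕ) × ℤ)
    {x y : EuclideanSpace ℝ (Fin d)} {ρ : ℝ} (hρ : ρ ≤ ‖x - y‖) :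
    ‖t q x y‖ₑ ≤ ENNReal.ofReal (weight δ q.1 * cutoff d ρ q.2) := by
  rw [← ofReal_norm, Real.norm_eq_abs]
  refine ENNReal.ofReal_le_ofReal ((ht.bound q x y).trans ?_)
  have := weight_pos δ q.1
  gcongr
  exact cutoff_anti hρ _

theorem summable (hd : 1 ≤ d) (hδ : 0 < δ) (ht : IsKernelFamily δ ω t)
    {x y : EuclideanSpace ℝ (Fin d)} (hxy : x ≠ y) : Summable fun q => t q x y := by
  have hpos : 0 < ‖x - y‖ := norm_pos_iff.2 (sub_ne_zero.2 hxy)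
  refine Summable.of_norm ?_
  have h : ∑' q, ‖t q x y‖ₑ ≠ ∞ := by
    refine ne_top_of_le_ne_top ?_ ((ENNReal.tsum_le_tsum fun q => ht.enorm_le q le_rfl).trans
      (tsum_weight_mul_cutoff_le hd δ hpos))
    have h1 := geomConst_ne_top hδ
    have h2 : geomConst d ≠ ∞ := geomConst_ne_top (by exact_mod_cast hd)
    finiteness
  simpa using ENNReal.summable_toReal h

end IsKernelFamily

/-- The constant in the size estimate. -/
def sizeConst (d : ℕ) (δ : ℝ) : ℝ :=
  (geomConst δ * geomConst δ * geomConst d).toReal * (d : ℝ) ^ d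

/-- The constant in the smoothness estimate. -/
def smoothConst (d : ℕ) (δ : ℝ) : ℝ :=
  24 * d * (geomConst δ * crossConst δ * geomConst (δ + d)).toReal * (4 ^ δ * (d : ℝ) ^ (δ + d))

theorem sizeConst_nonneg (d : ℕ) (δ : ℝ) : 0 ≤ sizeConst d δ := by
  unfold sizeConst
  positivity

theorem smoothConst_nonneg (d : ℕ) (δ : ℝ) : 0 ≤ smoothConst d δ := by
  unfold smoothConst
  positivity

theorem tsum_weight_mul_cutoff_le_sizeConst (hd : 1 ≤ d) {δ : ℝ} (hδ : 0 < δ) {ρ : ℝ}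
    (hρ : 0 < ρ) :
    ∑' q : (ℕ × ℕ) × ℤ, ENNReal.ofReal (weight δ q.1 * cutoff d ρ q.2) ≤
      ENNReal.ofReal (sizeConst d δ / ρ ^ d) := by
  refine (tsum_weight_mul_cutoff_le hd δ hρ).trans (le_of_eq ?_)
  have h1 := geomConst_ne_top hδ
  have h2 : geomConst d ≠ ∞ := geomConst_ne_top (by exact_mod_cast hd)
  rw [sizeConst, mul_div_assoc, ← div_pow, ENNReal.ofReal_mul ENNReal.toReal_nonneg,
    ENNReal.ofReal_toReal (by finiteness)]
  ring

theorem IsKernelFamily.enorm_tsum_le (hd : 1 ≤ d) {δ : ℝ} (hδ : 0 < δ) {ω : Omega d}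
    {t : (ℕ × ℕ) × ℤ → EuclideanSpace ℝ (Fin d) → EuclideanSpace ℝ (Fin d) → ℝ}
    (ht : IsKernelFamily δ ω t) {x y : EuclideanSpace ℝ (Fin d)} {ρ : ℝ} (hρ : 0 < ρ)
    (hxy : ρ ≤ ‖x - y‖) :
    ‖∑' q, t q x y‖ₑ ≤ ENNReal.ofReal (sizeConst d δ / ρ ^ d) :=
  enorm_tsum_le_tsum_enorm.trans ((ENNReal.tsum_le_tsum fun q => ht.enorm_le q hxy).trans
      (tsum_weight_mul_cutoff_le_sizeConst hd hδ hρ))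

/-- The oscillation of the kernels near `x`, at distance at least `ρ` from the diagonal, has a
measurable majorant in `ω` with small expectation. -/
theorem exists_oscillation_majorant (hd : 1 ≤ d) {δ : ℝ} (hδ0 : 0 < δ) (hδ1 : δ < 1)
    (x : EuclideanSpace ℝ (Fin d)) {r ρ : ℝ} (hr : 0 < r) (hρ : 0 < ρ) :
    ∃ M : Omega d → ℝ≥0∞, Measurable M ∧ (∀ ω, M ω ≠ ∞) ∧
      ∫⁻ ω, M ω ∂(prob d) ≤ ENNReal.ofReal (smoothConst d δ * r ^ δ / ρ ^ (δ + d)) ∧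
      ∀ (ω : Omega d) (t : (ℕ × ℕ) × ℤ → EuclideanSpace ℝ (Fin d) → EuclideanSpace ℝ (Fin d) → ℝ),
        IsKernelFamily δ ω t → ∀ x' y, ‖x - x'‖ ≤ r → ρ ≤ ‖x - y‖ → ρ ≤ ‖x' - y‖ →
          ‖(∑' q, t q x y) - ∑' q, t q x' y‖ₑ ≤ M ω ∧
          ‖(∑' q, t q y x) - ∑' q, t q y x'‖ₑ ≤ M ω := by
  -- After renaming, `2^(N-1) < r ≤ 2^N`.
  obtain ⟨N', hN1, hN2⟩ := exists_mem_Ioc_zpow hr (one_lt_two : (1 : ℝ) < 2)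
  obtain ⟨N, rfl⟩ : ∃ N, N' = N - 1 := ⟨N' + 1, by ring⟩
  rw [sub_add_cancel] at hN2
  choose U hUm hUp hU using fun j => exists_measurableSet_separating x N j
  let c : (ℕ × ℕ) × ℤ → ℝ≥0∞ := fun q => ENNReal.ofReal (weight δ q.1 * cutoff d ρ q.2)
  -- Off `V q` the kernel `t q` is unchanged in either variable; on `V q` its change is at most `2 *
  -- c q`. The resulting majorant depends neither on `t` nor on the other point, so it is measurable
  -- although `t` need not be.
  let V : (ℕ × ℕ) × ℤ → Set (Omega d) := fun q => U (q.2 - q.1.1 - 1) ∪ U (q.2 - q.1.2 - 1)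
  have hV : ∀ q, MeasurableSet (V q) := fun q => (hUm _).union (hUm _)
  have hc : ∑' q, c q ≠ ∞ :=
    ne_top_of_le_ne_top ENNReal.ofReal_ne_top (tsum_weight_mul_cutoff_le_sizeConst hd hδ0 hρ)
  refine ⟨fun ω => ∑' q, (V q).indicator (fun _ => 2 * c q) ω, ?_, ?_, ?_, ?_⟩
  · exact Measurable.tsum fun q => measurable_const.indicator (hV q)
  · intro ω
    refine ne_top_of_le_ne_top (b := ∑' q, 2 * c q) ?_
      (ENNReal.tsum_le_tsum fun q => Set.indicator_le_self' (fun _ _ => zero_le) ω)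
    rw [ENNReal.tsum_mul_left]
    finiteness
  · rw [lintegral_tsum fun q => (measurable_const.indicator (hV q)).aemeasurable]
    simp only [lintegral_indicator_const (hV _)]
    have hswap : ∀ g : (ℕ × ℕ) × ℤ → ℝ≥0∞, ∑' q : (ℕ × ℕ) × ℤ, g ((q.1.2, q.1.1), q.2) = ∑' q, g q :=
      fun g => (Equiv.prodCongr (Equiv.prodComm ℕ ℕ) (Equiv.refl ℤ)).tsum_eq g
    have hone : ∑' q : (ℕ × ℕ) × ℤ, 2 * c q * prob d (U (q.2 - q.1.1 - 1)) ≤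
        ENNReal.ofReal (12 * d) * (geomConst δ * crossConst δ * geomConst (δ + d) *
          ENNReal.ofReal ((2 : ℝ) ^ (((N : ℝ) + 1) * δ) * (d / ρ) ^ (δ + d))) := by
      refine le_trans ?_ (mul_le_mul_right (tsum_weight_mul_cutoff_mul_min_le hd hδ0 hρ N) _)
      rw [← ENNReal.tsum_mul_left]
      refine ENNReal.tsum_le_tsum fun q => ?_
      refine (mul_le_mul_right (hUp _) _).trans (le_of_eq ?_)
      have hw := mul_nonneg (weight_pos δ q.1).le (cutoff_nonneg (d := d) ρ q.2)
      have h2 : (2 : ℝ≥0∞) = ENNReal.ofReal 2 := by simp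
      rw [h2, ← ENNReal.ofReal_mul zero_le_two, ← ENNReal.ofReal_mul (by positivity),
        ← ENNReal.ofReal_mul (by positivity)]
      congr 1
      ring
    -- The weights are symmetric in `m` and `n`, so the second variable costs the same as the first.
    -- Hence `24 = 2 · 2 · 6`.
    have htwo : ∑' q : (ℕ × ℕ) × ℤ, 2 * c q * prob d (U (q.2 - q.1.2 - 1)) =
        ∑' q : (ℕ × ℕ) × ℤ, 2 * c q * prob d (U (q.2 - q.1.1 - 1)) := by
      rw [← hswap]
      refine tsum_congr fun q => ?_
      have : c ((q.1.2, q.1.1), q.2) = c q := by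
        simp only [c, weight, add_comm]
      rw [this]
    calc _ ≤ ∑' q : (ℕ × ℕ) × ℤ, (2 * c q * prob d (U (q.2 - q.1.1 - 1)) +
          2 * c q * prob d (U (q.2 - q.1.2 - 1))) := by
          refine ENNReal.tsum_le_tsum fun q => ?_
          rw [← mul_add]
          gcongr
          exact measure_union_le _ _
      _ ≤ ENNReal.ofReal (24 * d) * (geomConst δ * crossConst δ * geomConst (δ + d) *
          ENNReal.ofReal ((2 : ℝ) ^ (((N : ℝ) + 1) * δ) * (d / ρ) ^ (δ + d))) := by
          rw [ENNReal.tsum_add, htwo, ← two_mul]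
          refine (mul_le_mul_right hone 2).trans (le_of_eq ?_)
          rw [← mul_assoc, show (2 : ℝ≥0∞) = ENNReal.ofReal 2 by simp,
            ← ENNReal.ofReal_mul zero_le_two]
          congr 2
          ring
      _ ≤ _ := by
          have h1 := geomConst_ne_top hδ0
          have h2 : geomConst (δ + d) ≠ ∞ := geomConst_ne_top (by positivity)
          have h3 := crossConst_ne_top hδ0 hδ1
          rw [← ENNReal.ofReal_toReal (show geomConst δ * crossConst δ * geomConst (δ + d) ≠ ∞ by
            finiteness), ← ENNReal.ofReal_mul (by positivity), ← ENNReal.ofReal_mul (by positivity)]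
          refine ENNReal.ofReal_le_ofReal ?_
          -- This is `2^(N+1) = 4 · 2^(N-1) ≤ 4 r`, raised to the power `δ`.
          have h4 : (2 : ℝ) ^ (((N : ℝ) + 1) * δ) ≤ 4 ^ δ * r ^ δ := by
            rw [← Real.mul_rpow (by norm_num) hr.le, Real.rpow_mul zero_le_two]
            refine Real.rpow_le_rpow (by positivity) ?_ hδ0.le
            have : (N : ℝ) + 1 = ((N - 1 + 2 : ℤ) : ℝ) := by push_cast; ring
            rw [this, Real.rpow_intCast, zpow_add₀ two_ne_zero]
            have : (2 : ℝ) ^ (2 : ℤ) = 4 := by norm_num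
            rw [this]
            linarith
          rw [Real.div_rpow (by positivity) hρ.le, smoothConst]
          calc _ ≤ 24 * d * ((geomConst δ * crossConst δ * geomConst (δ + d)).toReal *
                ((4 ^ δ * r ^ δ) * ((d : ℝ) ^ (δ + d) / ρ ^ (δ + d)))) := by gcongr
            _ = _ := by ring
  · intro ω t ht x' y hx' hxy hx'y
    have hne : x ≠ y := by
      rintro rfl
      simp at hxy
      linarith
    have hne' : x' ≠ y := by
      rintro rfl
      simp at hx'y
      linarith
    have hN : ‖x - x'‖ ≤ 2 ^ N := hx'.trans hN2
    constructor
    · rw [← (ht.summable hd hδ0 hne).tsum_sub (ht.summable hd hδ0 hne')]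
      refine enorm_tsum_le_tsum_enorm.trans (ENNReal.tsum_le_tsum fun q => ?_)
      by_cases hω : ω ∈ V q
      · rw [Set.indicator_of_mem hω, two_mul]
        exact (enorm_sub_le).trans (add_le_add (ht.enorm_le q hxy) (ht.enorm_le q hx'y))
      · rw [ht.left q x x' y (hU _ ω (fun h => hω (Or.inl h)) x' hN)]
        simp
    · rw [← (ht.summable hd hδ0 hne.symm).tsum_sub (ht.summable hd hδ0 hne'.symm)]
      refine enorm_tsum_le_tsum_enorm.trans (ENNReal.tsum_le_tsum fun q => ?_)
      rw [norm_sub_rev] at hxy hx'y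
      by_cases hω : ω ∈ V q
      · rw [Set.indicator_of_mem hω, two_mul]
        exact (enorm_sub_le).trans (add_le_add (ht.enorm_le q hxy) (ht.enorm_le q hx'y))
      · rw [ht.right q y x x' (hU _ ω (fun h => hω (Or.inr h)) x' hN)]
        simp

/-! ### Representation of the shifts by kernels on separated functions. -/

theorem scalePart_congr_ae (ω : Omega d) (m n : ℕ)
    (hin hout : Cube d → Cube d → EuclideanSpace ℝ (Fin d) → ℝ) (k : ℤ)
    {f f' : EuclideanSpace ℝ (Fin d) → ℝ} (h : f =ᵐ[volume] f') (x : EuclideanSpace ℝ (Fin d)) :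
    scalePart ω m n hin hout k f x = scalePart ω m n hin hout k f' x := by
  have e : ∀ Q' Q'', ∫ y, f y * hin Q' Q'' y = ∫ y, f' y * hin Q' Q'' y := by
    intro Q' Q''
    refine integral_congr_ae ?_
    filter_upwards [h] with y hy
    rw [hy]
  simp only [scalePart, e]

theorem summable_cutoff (hd : 1 ≤ d) {ρ : ℝ} (hρ : 0 < ρ) : Summable (cutoff d ρ) := by
  have h := tsum_cutoff_le hd le_rfl hρ
  simp only [mul_zero, neg_zero, Real.rpow_zero, mul_one, zero_add] at h
  have h' : ∑' k, ENNReal.ofReal (cutoff d ρ k) ≠ ∞ :=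
    ne_top_of_le_ne_top (ENNReal.mul_ne_top ENNReal.ofReal_ne_top
      (geomConst_ne_top (by exact_mod_cast hd))) h
  simpa only [ENNReal.toReal_ofReal (cutoff_nonneg ρ _)] using ENNReal.summable_toReal h'

theorem summable_weight_mul_cutoff (hd : 1 ≤ d) {δ : ℝ} (hδ : 0 < δ) {ρ : ℝ} (hρ : 0 < ρ) :
    Summable fun q : (ℕ × ℕ) × ℤ => weight δ q.1 * cutoff d ρ q.2 := by
  have h' := ne_top_of_le_ne_top ENNReal.ofReal_ne_top
    (tsum_weight_mul_cutoff_le_sizeConst hd hδ hρ)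
  simpa only [ENNReal.toReal_ofReal (mul_nonneg (weight_pos δ _).le (cutoff_nonneg ρ _))] using
    ENNReal.summable_toReal h'

section Separated

variable {f g : EuclideanSpace ℝ (Fin d) → ℝ} {ρ : ℝ}

/-- A series of kernels with a summable bound away from the diagonal can be integrated termwise. -/
theorem summable_integral_mul {ι : Type*}
    {w : EuclideanSpace ℝ (Fin d) × EuclideanSpace ℝ (Fin d) → ℝ}
    (hw : Integrable w (volume.prod volume))
    {s : ι → EuclideanSpace ℝ (Fin d) × EuclideanSpace ℝ (Fin d) → ℝ} {b : ι → ℝ}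
    (hs : ∀ i z, w z ≠ 0 → |s i z| ≤ b i) (hb : Summable b) :
    Summable fun i => ∫ z, ‖w z * s i z‖ ∂(volume.prod volume) := by
  refine Summable.of_nonneg_of_le (fun i => by positivity) (fun i => ?_)
    (hb.mul_right (∫ z, ‖w z‖ ∂(volume.prod volume)))
  rw [← integral_const_mul]
  refine integral_mono_of_nonneg (Eventually.of_forall fun z => norm_nonneg _)
    (hw.norm.const_mul _) (Eventually.of_forall fun z => ?_)
  simp only [norm_mul]
  by_cases hz : w z = 0
  · simp [hz]
  · rw [mul_comm]
    gcongr
    exact hs i z hz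

/-- A Haar shift is represented by its kernel on separated functions. -/
theorem inner_eq_tsum_integral (hd : 1 ≤ d) {ω : Omega d} {m n : ℕ}
    {hin hout : Cube d → Cube d → EuclideanSpace ℝ (Fin d) → ℝ}
    (H : IsShiftData ω m n hin hout) (hf : MemLp f 2 volume) (hg : MemLp g 2 volume)
    (hf1 : Integrable f) (hg1 : Integrable g) (hρ : 0 < ρ)
    (hsep : ∀ x y, f y * g x ≠ 0 → ρ ≤ ‖x - y‖) {a : ℝ}
    (ha : Tendsto (fun N : ℕ => ∫ x, (∑ k ∈ Finset.Icc (-(N : ℤ)) N,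
      scalePart ω m n hin hout k (hf.toLp f) x) * (hg.toLp g) x) atTop (𝓝 a)) :
    a = ∑' k : ℤ, ∫ z : EuclideanSpace ℝ (Fin d) × EuclideanSpace ℝ (Fin d),
        f z.2 * g z.1 * scaleKernel ω m n hin hout k z.1 z.2 ∂(volume.prod volume) := by
  have hw : Integrable (fun z : EuclideanSpace ℝ (Fin d) × EuclideanSpace ℝ (Fin d) =>
      f z.2 * g z.1) (volume.prod volume) := by
    simpa only [mul_comm] using hg1.mul_prod hf1
  have hsum := summable_integral_mul (ι := ℤ) hw
    (s := fun k z => scaleKernel ω m n hin hout k z.1 z.2) (b := cutoff d ρ)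
    (fun k z hz => (abs_scaleKernel_le H k _ _).trans (cutoff_anti (hsep _ _ hz) _))
    (summable_cutoff hd hρ)
  have hsum' : Summable fun k : ℤ => ∫ z : EuclideanSpace ℝ (Fin d) × EuclideanSpace ℝ (Fin d),
        f z.2 * g z.1 * scaleKernel ω m n hin hout k z.1 z.2 ∂(volume.prod volume) :=
    Summable.of_norm_bounded hsum fun k => norm_integral_le_integral_norm _
  -- Separation makes the series over scales absolutely convergent, so its symmetric partial sums
  -- identify the weak limit.
  have hlim := hsum'.hasSum.comp
    ((Finset.tendsto_Icc_neg_atTop_atTop (α := ℤ)).comp tendsto_natCast_atTop_atTop)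
  refine tendsto_nhds_unique (ha.congr fun N => ?_) hlim
  calc _ = ∫ x, ∑ k ∈ Finset.Icc (-(N : ℤ)) N, scalePart ω m n hin hout k f x * g x := by
        refine integral_congr_ae ?_
        filter_upwards [hg.coeFn_toLp] with x hx
        rw [hx, Finset.sum_mul]
        refine Finset.sum_congr rfl fun k _ => ?_
        rw [scalePart_congr_ae ω m n hin hout k hf.coeFn_toLp]
    _ = _ := by
        rw [integral_finsetSum _ fun k _ => (integral_scalePart_mul H k hf1 hg1).1]
        exact Finset.sum_congr rfl fun k _ => (integral_scalePart_mul H k hf1 hg1).2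

theorem IsKernelFamily.hasSum_integral (hd : 1 ≤ d) {δ : ℝ} (hδ : 0 < δ) {ω : Omega d}
    {t : (ℕ × ℕ) × ℤ → EuclideanSpace ℝ (Fin d) → EuclideanSpace ℝ (Fin d) → ℝ}
    (ht : IsKernelFamily δ ω t)
    {w : EuclideanSpace ℝ (Fin d) × EuclideanSpace ℝ (Fin d) → ℝ}
    (hw : Integrable w (volume.prod volume)) (hρ : 0 < ρ)
    (hsep : ∀ z, w z ≠ 0 → ρ ≤ ‖z.1 - z.2‖) :
    Integrable (fun z => w z * ∑' q, t q z.1 z.2) (volume.prod volume) ∧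
    HasSum (fun q => ∫ z, w z * t q z.1 z.2 ∂(volume.prod volume))
      (∫ z, w z * ∑' q, t q z.1 z.2 ∂(volume.prod volume)) := by
  have hb : ∀ q z, w z ≠ 0 → |t q z.1 z.2| ≤ weight δ q.1 * cutoff d ρ q.2 := by
    intro q z hz
    refine (ht.bound q _ _).trans ?_
    have := weight_pos δ q.1
    gcongr
    exact cutoff_anti (hsep z hz) _
  constructor
  · refine Integrable.mono' (hw.norm.mul_const (sizeConst d δ / ρ ^ d))
      (hw.aestronglyMeasurable.mul (Measurable.tsum ht.measurable).aestronglyMeasurable)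
      (Eventually.of_forall fun z => ?_)
    rw [norm_mul]
    by_cases hz : w z = 0
    · simp [hz]
    · gcongr
      have h := ht.enorm_tsum_le hd hδ hρ (hsep z hz)
      rwa [← ofReal_norm, ENNReal.ofReal_le_ofReal_iff
        (div_nonneg (sizeConst_nonneg d δ) (by positivity))] at h
  · have hsum := summable_integral_mul (s := fun q z => t q z.1 z.2) hw hb
      (summable_weight_mul_cutoff hd hδ hρ)
    have h := hasSum_integral_of_summable_integral_norm
      (F := fun q z => w z * t q z.1 z.2) (fun q => ?_) hsum
    · simpa only [tsum_mul_left] using h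
    · refine Integrable.mono' (hw.norm.mul_const (weight δ q.1 * cutoff d ρ q.2))
        (hw.aestronglyMeasurable.mul (ht.measurable q).aestronglyMeasurable)
        (Eventually.of_forall fun z => ?_)
      rw [norm_mul]
      by_cases hz : w z = 0
      · simp [hz]
      · gcongr
        exact hb q z hz

end Separated

/-- The kernels of a weighted family of Haar shifts on `𝒟_ω`. -/
theorem exists_isKernelFamily (hd : 1 ≤ d) {δ : ℝ} (hδ : 0 < δ) {ω : Omega d}
    {lam : ℕ → ℕ → ℝ}
    {𝕊 : ℕ → ℕ → (Lp ℝ 2 (volume : Measure (EuclideanSpace ℝ (Fin d))) →L[ℝ]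
            Lp ℝ 2 (volume : Measure (EuclideanSpace ℝ (Fin d))))}
    (hlam : ∀ m n, |lam m n| ≤ weight δ (m, n)) (hS : ∀ m n, IsHaarShift ω m n (𝕊 m n)) :
    ∃ t : (ℕ × ℕ) × ℤ → EuclideanSpace ℝ (Fin d) → EuclideanSpace ℝ (Fin d) → ℝ,
      IsKernelFamily δ ω t ∧
      ∀ (f g : EuclideanSpace ℝ (Fin d) → ℝ) (hf : MemLp f 2 volume) (hg : MemLp g 2 volume),
        Integrable f → Integrable g →
        ∀ ρ : ℝ, 0 < ρ → (∀ x y, f y * g x ≠ 0 → ρ ≤ ‖x - y‖) →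
        ∑' p : ℕ × ℕ, lam p.1 p.2 * inner ℝ (𝕊 p.1 p.2 (hf.toLp f)) (hg.toLp g) =
          ∫ z : EuclideanSpace ℝ (Fin d) × EuclideanSpace ℝ (Fin d),
            f z.2 * g z.1 * ∑' q, t q z.1 z.2 ∂(volume.prod volume) := by
  choose hin hout H hlim using hS
  have H' : ∀ m n, IsShiftData ω m n (hin m n) (hout m n) := H
  let t : (ℕ × ℕ) × ℤ → EuclideanSpace ℝ (Fin d) → EuclideanSpace ℝ (Fin d) → ℝ := fun q x y =>
    lam q.1.1 q.1.2 * scaleKernel ω q.1.1 q.1.2 (hin q.1.1 q.1.2) (hout q.1.1 q.1.2) q.2 x y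
  have ht : IsKernelFamily δ ω t := by
    refine ⟨fun q x y => ?_, fun q x x' y h => ?_, fun q x y y' h => ?_, fun q => ?_⟩
    · rw [abs_mul]
      exact mul_le_mul (hlam _ _) (abs_scaleKernel_le (H' _ _) _ _ _) (abs_nonneg _)
        (weight_pos _ _).le
    · simp only [t]
      rw [scaleKernel_eq_left (H' _ _) y h]
    · simp only [t]
      rw [scaleKernel_eq_right (H' _ _) x h]
    · exact (measurable_scaleKernel (H' _ _) _).const_mul _
  refine ⟨t, ht, ?_⟩
  intro f g hf hg hf1 hg1 ρ hρ hsep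
  have hw : Integrable (fun z : EuclideanSpace ℝ (Fin d) × EuclideanSpace ℝ (Fin d) =>
      f z.2 * g z.1) (volume.prod volume) := by
    simpa only [mul_comm] using hg1.mul_prod hf1
  have hs := (ht.hasSum_integral hd hδ hw hρ fun z hz => hsep _ _ hz).2
  rw [← hs.tsum_eq, hs.summable.tsum_prod]
  refine tsum_congr fun p => ?_
  rw [inner_eq_tsum_integral hd (H' p.1 p.2) hf hg hf1 hg1 hρ hsep (hlim p.1 p.2 _ _),
    ← tsum_mul_left]
  refine tsum_congr fun k => ?_
  rw [← integral_const_mul]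
  congr 1
  funext z
  simp only [t]
  ring

/-! ### The averaged operator. -/

theorem exists_continuousLinearMap_inner_eq {H : Type*} [NormedAddCommGroup H]
    [InnerProductSpace ℝ H] [CompleteSpace H] (B : H → H → ℝ) (C : ℝ)
    (hal : ∀ f f' g, B (f + f') g = B f g + B f' g) (hsl : ∀ (c : ℝ) f g, B (c • f) g = c * B f g)
    (har : ∀ f g g', B f (g + g') = B f g + B f g') (hsr : ∀ (c : ℝ) f g, B f (c • g) = c * B f g)
    (hC : ∀ f g, |B f g| ≤ C * ‖f‖ * ‖g‖) :
    ∃ S : H →L[ℝ] H, ∀ f g, inner ℝ (S f) g = B f g := by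
  let b : H →L⋆[ℝ] H →L[ℝ] ℝ := LinearMap.mkContinuous₂
    (LinearMap.mk₂'ₛₗ (starRingEnd ℝ) (RingHom.id ℝ) B hal (fun c f g => by simpa using hsl c f g)
      har (fun c f g => by simpa using hsr c f g)) C hC
  refine ⟨InnerProductSpace.continuousLinearMapOfBilin b, fun f g => ?_⟩
  rw [InnerProductSpace.continuousLinearMapOfBilin_apply]
  rfl

/-- The average of a bounded, weakly measurable family of weighted series of operators. -/
theorem exists_average_operator {H : Type*} [NormedAddCommGroup H]
    [InnerProductSpace ℝ H] [CompleteSpace H] {Ω : Type*} [MeasurableSpace Ω] (μ : Measure Ω)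
    [IsProbabilityMeasure μ] {δ : ℝ} (hδ : 0 < δ) {lam : Ω → ℕ → ℕ → ℝ} {𝕊 : Ω → ℕ → ℕ → H →L[ℝ] H}
    (hlam : ∀ ω m n, |lam ω m n| ≤ weight δ (m, n)) (hS : ∀ ω m n, ‖𝕊 ω m n‖ ≤ 1)
    (hmeas : ∀ f g : H, AEMeasurable
      (fun ω => ∑' p : ℕ × ℕ, lam ω p.1 p.2 * inner ℝ (𝕊 ω p.1 p.2 f) g) μ) :
    (∀ f g : H, Integrable
      (fun ω => ∑' p : ℕ × ℕ, lam ω p.1 p.2 * inner ℝ (𝕊 ω p.1 p.2 f) g) μ) ∧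
    ∃ S : H →L[ℝ] H, ∀ f g, inner ℝ (S f) g =
      ∫ ω, ∑' p : ℕ × ℕ, lam ω p.1 p.2 * inner ℝ (𝕊 ω p.1 p.2 f) g ∂μ := by
  have hb : ∀ ω f g (p : ℕ × ℕ), ‖lam ω p.1 p.2 * inner ℝ (𝕊 ω p.1 p.2 f) g‖ ≤
      weight δ p * (‖f‖ * ‖g‖) := by
    intro ω f g p
    rw [norm_mul, Real.norm_eq_abs]
    refine mul_le_mul (hlam ω p.1 p.2) ?_ (norm_nonneg _) (weight_pos _ _).le
    refine (norm_inner_le_norm _ _).trans ?_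
    gcongr
    exact ((𝕊 ω p.1 p.2).le_of_opNorm_le (hS ω p.1 p.2) f).trans (by rw [one_mul])
  have hws : ∀ f g : H, Summable fun p => weight δ p * (‖f‖ * ‖g‖) :=
    fun f g => (summable_weight hδ).mul_right _
  have hsum : ∀ ω f g, Summable fun p : ℕ × ℕ => lam ω p.1 p.2 * inner ℝ (𝕊 ω p.1 p.2 f) g :=
    fun ω f g => Summable.of_norm_bounded (hws f g) (hb ω f g)
  have hbd : ∀ ω f g, ‖∑' p : ℕ × ℕ, lam ω p.1 p.2 * inner ℝ (𝕊 ω p.1 p.2 f) g‖ ≤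
      (∑' p, weight δ p) * (‖f‖ * ‖g‖) := by
    intro ω f g
    rw [← tsum_mul_right]
    exact tsum_of_norm_bounded (hws f g).hasSum (hb ω f g)
  have hint : ∀ f g : H, Integrable
      (fun ω => ∑' p : ℕ × ℕ, lam ω p.1 p.2 * inner ℝ (𝕊 ω p.1 p.2 f) g) μ := fun f g =>
    Integrable.of_bound (hmeas f g).aestronglyMeasurable _ (Eventually.of_forall fun ω => hbd ω f g)
  refine ⟨hint, exists_continuousLinearMap_inner_eq _ (∑' p, weight δ p) ?_ ?_ ?_ ?_ ?_⟩
  · intro f f' g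
    rw [← integral_add (hint _ _) (hint _ _)]
    congr 1
    funext ω
    rw [← (hsum ω f g).tsum_add (hsum ω f' g)]
    simp only [map_add, inner_add_left, mul_add]
  · intro c f g
    rw [← integral_const_mul]
    congr 1
    funext ω
    rw [← tsum_mul_left]
    simp only [map_smul, real_inner_smul_left, mul_left_comm]
  · intro f g g'
    rw [← integral_add (hint _ _) (hint _ _)]
    congr 1
    funext ω
    rw [← (hsum ω f g).tsum_add (hsum ω f g')]
    simp only [inner_add_right, mul_add]
  · intro c f g
    rw [← integral_const_mul]
    congr 1
    funext ω
    rw [← tsum_mul_left]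
    simp only [real_inner_smul_right, mul_left_comm]
  · intro f g
    have h := norm_integral_le_of_norm_le_const (μ := μ) (Eventually.of_forall fun ω => hbd ω f g)
    simpa [mul_assoc] using h

theorem integrable_of_bounded_of_hasCompactSupport {f : EuclideanSpace ℝ (Fin d) → ℝ}
    (hf : MemLp f 2 volume) {B : ℝ} (hB : ∀ x, |f x| ≤ B) (hc : HasCompactSupport f) :
    Integrable f := by
  have h := Measure.integrableOn_of_bounded (s := tsupport f) (hc.isCompact.measure_lt_top.ne)
    hf.aestronglyMeasurable (M := B) (Eventually.of_forall hB)
  exact h.integrable_of_forall_notMem_eq_zero fun x hx => image_eq_zero_of_notMem_tsupport hx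

/-! ### The averaged kernel. -/

/-- The average of the kernels over all grids. -/
def averageKernel (Λ : (Omega d → ℝ) →ₗ[ℝ] ℝ)
    (t : Omega d → (ℕ × ℕ) × ℤ → EuclideanSpace ℝ (Fin d) → EuclideanSpace ℝ (Fin d) → ℝ)
    (x y : EuclideanSpace ℝ (Fin d)) : ℝ :=
  Λ fun ω => ∑' q, t ω q x y

section Average

variable {δ : ℝ} {Λ : (Omega d → ℝ) →ₗ[ℝ] ℝ}
  {t : Omega d → (ℕ × ℕ) × ℤ → EuclideanSpace ℝ (Fin d) → EuclideanSpace ℝ (Fin d) → ℝ}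

/-- Both points stay at distance at least `ρ = |x - y| / 2` from `y`, whence `2^(δ+d)`; the factor
`2` counts the two differences, and the summand `1` only makes the constant positive. -/
theorem isStandardKernel_averageKernel (hd : 1 ≤ d) (hδ0 : 0 < δ) (hδ1 : δ < 1)
    (hΛ : ∀ (F : Omega d → ℝ) (G : Omega d → ℝ≥0∞), AEMeasurable G (prob d) →
      (∀ ω, ‖F ω‖ₑ ≤ G ω) → ‖Λ F‖ₑ ≤ ∫⁻ ω, G ω ∂(prob d))
    (ht : ∀ ω, IsKernelFamily δ ω (t ω)) :
    IsStandardKernel (1 + sizeConst d δ + 2 * (smoothConst d δ * 2 ^ (δ + d))) δ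
      (averageKernel Λ t) := by
  have hs0 := sizeConst_nonneg d δ
  have hs1 := smoothConst_nonneg d δ
  constructor
  · intro x y hxy
    have hpos : 0 < ‖x - y‖ := norm_pos_iff.2 (sub_ne_zero.2 hxy)
    have h := hΛ (fun ω => ∑' q, t ω q x y) _ aemeasurable_const
      (fun ω => (ht ω).enorm_tsum_le hd hδ0 hpos le_rfl)
    rw [lintegral_const, measure_univ, mul_one, ← ofReal_norm,
      ENNReal.ofReal_le_ofReal_iff (by positivity)] at h
    refine h.trans ?_
    gcongr
    have : 0 ≤ smoothConst d δ * 2 ^ (δ + d) := by positivity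
    linarith
  · intro x x' y hxy hx'
    have hpos : 0 < ‖x - y‖ := norm_pos_iff.2 (sub_ne_zero.2 hxy)
    rcases eq_or_ne x x' with rfl | hne
    · simp only [sub_self, abs_zero, add_zero]
      positivity
    have hr : 0 < ‖x - x'‖ := norm_pos_iff.2 (sub_ne_zero.2 hne)
    have hx'y : ‖x - y‖ / 2 ≤ ‖x' - y‖ := by
      have : ‖x - y‖ ≤ ‖x - x'‖ + ‖x' - y‖ := norm_sub_le_norm_sub_add_norm_sub x x' y
      linarith
    obtain ⟨M, hMm, -, hMi, hM⟩ :=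
      exists_oscillation_majorant hd hδ0 hδ1 x hr (half_pos hpos)
    have key : ∀ F G : Omega d → ℝ, (∀ ω, ‖F ω - G ω‖ₑ ≤ M ω) → |Λ F - Λ G| ≤
        smoothConst d δ * 2 ^ (δ + d) * ‖x - x'‖ ^ δ / ‖x - y‖ ^ (δ + d) := by
      intro F G h
      have h1 := (hΛ (F - G) M hMm.aemeasurable h).trans hMi
      rw [map_sub, ← ofReal_norm, ENNReal.ofReal_le_ofReal_iff (by positivity)] at h1
      refine h1.trans (le_of_eq ?_)
      rw [Real.div_rpow hpos.le zero_le_two]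
      field_simp
    have h1 := key _ _ fun ω => (hM ω (t ω) (ht ω) x' y le_rfl (by linarith) hx'y).1
    have h2 := key _ _ fun ω => (hM ω (t ω) (ht ω) x' y le_rfl (by linarith) hx'y).2
    refine (add_le_add h1 h2).trans ?_
    rw [← add_div, ← add_mul, ← two_mul]
    gcongr
    linarith

theorem integral_averageKernel (hd : 1 ≤ d) (hδ0 : 0 < δ) (hδ1 : δ < 1)
    (hΛ : ∀ (F : Omega d → ℝ) (G : Omega d → ℝ≥0∞), AEMeasurable G (prob d) →
      (∀ ω, ‖F ω‖ₑ ≤ G ω) → ‖Λ F‖ₑ ≤ ∫⁻ ω, G ω ∂(prob d))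
    (ht : ∀ ω, IsKernelFamily δ ω (t ω)) {f g : EuclideanSpace ℝ (Fin d) → ℝ}
    (hf : Integrable f) (hg : Integrable g)
    (hfc : HasCompactSupport f) (hgc : HasCompactSupport g) {ρ : ℝ} (hρ : 0 < ρ)
    (hsep : ∀ x ∈ tsupport g, ∀ y ∈ tsupport f, ρ ≤ ‖x - y‖) :
    Integrable (fun z : EuclideanSpace ℝ (Fin d) × EuclideanSpace ℝ (Fin d) =>
      f z.2 * g z.1 * averageKernel Λ t z.1 z.2) (volume.prod volume) ∧
    Λ (fun ω => ∫ z : EuclideanSpace ℝ (Fin d) × EuclideanSpace ℝ (Fin d),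
        f z.2 * g z.1 * ∑' q, t ω q z.1 z.2 ∂(volume.prod volume)) =
      ∫ z : EuclideanSpace ℝ (Fin d) × EuclideanSpace ℝ (Fin d),
        f z.2 * g z.1 * averageKernel Λ t z.1 z.2 ∂(volume.prod volume) := by
  have hw : Integrable (fun z : EuclideanSpace ℝ (Fin d) × EuclideanSpace ℝ (Fin d) =>
      f z.2 * g z.1) (volume.prod volume) := by
    simpa only [mul_comm] using hg.mul_prod hf
  have hw0 : ∀ z ∉ tsupport g ×ˢ tsupport f, f z.2 * g z.1 = 0 := by
    intro z hz
    rw [Set.mem_prod, not_and_or] at hz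
    rcases hz with h | h
    · rw [image_eq_zero_of_notMem_tsupport h, mul_zero]
    · rw [image_eq_zero_of_notMem_tsupport h, zero_mul]
  refine integral_linear_extension hΛ (hgc.isCompact.prod hfc.isCompact) hw hw0
    (k := fun ω z => ∑' q, t ω q z.1 z.2) (fun ω => ?_) ?_
  · refine ((ht ω).hasSum_integral hd hδ0 hw hρ fun z hz => ?_).1
    have hz' := not_imp_comm.1 (hw0 z) hz
    exact hsep _ hz'.1 _ hz'.2
  · intro ε hε
    have hlim : Tendsto (fun r : ℝ => smoothConst d δ * r ^ δ / ρ ^ (δ + d)) (𝓝[>] 0) (𝓝 0) := by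
      have h : Tendsto (fun r : ℝ => smoothConst d δ * r ^ δ / ρ ^ (δ + d)) (𝓝 0)
          (𝓝 (smoothConst d δ * 0 ^ δ / ρ ^ (δ + d))) :=
        (((Real.continuous_rpow_const hδ0.le).tendsto 0).const_mul _).div_const _
      rw [Real.zero_rpow hδ0.ne', mul_zero, zero_div] at h
      exact h.mono_left nhdsWithin_le_nhds
    obtain ⟨r, hrε, hr⟩ := ((hlim.eventually_le_const (half_pos hε)).and
      self_mem_nhdsWithin).exists
    have hr' : 0 < r := hr
    refine ⟨r, hr', ?_⟩
    rintro ⟨x₀, y₀⟩ ⟨hx₀, hy₀⟩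
    obtain ⟨M, hMm, hMt, hMi, hM⟩ := exists_oscillation_majorant hd hδ0 hδ1 x₀ hr' hρ
    obtain ⟨M', hMm', hMt', hMi', hM'⟩ := exists_oscillation_majorant hd hδ0 hδ1 y₀ hr' hρ
    refine ⟨fun ω => M ω + M' ω, hMm.add hMm', fun ω => ENNReal.add_ne_top.2 ⟨hMt ω, hMt' ω⟩,
      ?_, ?_⟩
    · rw [lintegral_add_left hMm, ← add_halves ε, ENNReal.ofReal_add (by positivity) (by positivity)]
      exact add_le_add (hMi.trans (ENNReal.ofReal_le_ofReal hrε))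
        (hMi'.trans (ENNReal.ofReal_le_ofReal hrε))
    -- Move one variable at a time: from `(x, y)` to `(x₀, y)`, then to `(x₀, y₀)`. Both moves stay
    -- within the two supports, at distance at least `ρ` from the diagonal.
    · rintro ⟨x, y⟩ ⟨hx, hy⟩ hdist ω
      rw [Prod.dist_eq, max_lt_iff, dist_comm, dist_comm y, dist_eq_norm, dist_eq_norm] at hdist
      have h1 := (hM ω (t ω) (ht ω) x y hdist.1.le (hsep _ hx₀ _ hy) (hsep _ hx _ hy)).1
      have h2 := (hM' ω (t ω) (ht ω) y x₀ hdist.2.le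
        (by rw [norm_sub_rev]; exact hsep _ hx₀ _ hy₀)
        (by rw [norm_sub_rev]; exact hsep _ hx₀ _ hy)).2
      rw [← enorm_neg, neg_sub] at h1 h2
      have h3 := (enorm_add_le _ _).trans (add_le_add h1 h2)
      rwa [sub_add_sub_cancel] at h3

end Average

end HaarShift

end

theorem theorem3p1 (d : ℕ) (hd : 1 ≤ d) (δ : ℝ) (hδ0 : 0 < δ) (hδ1 : δ < 1) :
    ∃ C : ℝ, 0 < C ∧
      ∀ (lam : HaarShift.Omega d → ℕ → ℕ → ℝ)
        (𝕊 : HaarShift.Omega d → ℕ → ℕ →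
          (Lp ℝ 2 (volume : Measure (EuclideanSpace ℝ (Fin d))) →L[ℝ]
            Lp ℝ 2 (volume : Measure (EuclideanSpace ℝ (Fin d))))),
        (∀ ω m n, |lam ω m n| ≤ (2 : ℝ) ^ (-(((m : ℝ) + n) * δ))) →
        (∀ ω m n, HaarShift.IsHaarShift ω m n (𝕊 ω m n)) →
        (∀ ω m n, ‖𝕊 ω m n‖ ≤ 1) →
        (∀ f g : Lp ℝ 2 (volume : Measure (EuclideanSpace ℝ (Fin d))),
          AEMeasurable (fun ω => ∑' p : ℕ × ℕ, lam ω p.1 p.2 * inner ℝ (𝕊 ω p.1 p.2 f) g)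
            (HaarShift.prob d)) →
        ∃ S : Lp ℝ 2 (volume : Measure (EuclideanSpace ℝ (Fin d))) →L[ℝ]
            Lp ℝ 2 (volume : Measure (EuclideanSpace ℝ (Fin d))),
          (∀ f g : Lp ℝ 2 (volume : Measure (EuclideanSpace ℝ (Fin d))),
            inner ℝ (S f) g =
              ∫ ω, ∑' p : ℕ × ℕ, lam ω p.1 p.2 * inner ℝ (𝕊 ω p.1 p.2 f) g ∂(HaarShift.prob d)) ∧
          HaarShift.IsCalderonZygmund C δ S := by
  have hs0 := HaarShift.sizeConst_nonneg d δ
  have hs1 := HaarShift.smoothConst_nonneg d δ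
  refine ⟨1 + HaarShift.sizeConst d δ + 2 * (HaarShift.smoothConst d δ * 2 ^ (δ + d)),
    by positivity, ?_⟩
  intro lam 𝕊 hlam hshift hnorm hmeas
  obtain ⟨hint, S, hS⟩ :=
    HaarShift.exists_average_operator (HaarShift.prob d) hδ0 hlam hnorm hmeas
  refine ⟨S, hS, ?_⟩
  -- The families are chosen grid by grid, so nothing is known about `t` as a function of `ω`.
  choose t ht hrep using fun ω => HaarShift.exists_isKernelFamily hd hδ0 (hlam ω) (hshift ω)
  obtain ⟨Λ, hΛint, hΛ⟩ := HaarShift.exists_linear_extension_integral (HaarShift.prob d)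
  refine ⟨HaarShift.averageKernel Λ t,
    HaarShift.isStandardKernel_averageKernel hd hδ0 hδ1 hΛ ht, ?_⟩
  rintro f g hf hg ⟨Bf, hBf⟩ ⟨Bg, hBg⟩ hfc hgc hdisj
  have hf1 := HaarShift.integrable_of_bounded_of_hasCompactSupport hf hBf hfc
  have hg1 := HaarShift.integrable_of_bounded_of_hasCompactSupport hg hBg hgc
  obtain ⟨ρ, hρ, hsep⟩ :=
    Metric.exists_pos_forall_lt_edist hgc.isCompact (isClosed_tsupport f) hdisj.symm
  have hsep' : ∀ x ∈ tsupport g, ∀ y ∈ tsupport f, (ρ : ℝ) ≤ ‖x - y‖ := by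
    intro x hx y hy
    have h := (hsep x hx y hy).le
    rw [edist_dist, dist_eq_norm, ← ENNReal.ofReal_coe_nnreal,
      ENNReal.ofReal_le_ofReal_iff (norm_nonneg _)] at h
    exact h
  obtain ⟨hi, he⟩ := HaarShift.integral_averageKernel hd hδ0 hδ1 hΛ ht hf1 hg1 hfc hgc
    (NNReal.coe_pos.2 hρ) hsep'
  refine ⟨hi, ?_⟩
  -- The total pairing is integrable in `ω`, so its expectation is its value under `Λ`, which may
  -- then be moved inside the double integral.
  rw [hS, ← hΛint _ (hint _ _), ← integral_prod_symm _ hi, ← he]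
  congr 1
  funext ω
  refine hrep ω f g hf hg hf1 hg1 ρ (NNReal.coe_pos.2 hρ) fun x y hxy => ?_
  refine hsep' x (subset_tsupport g ?_) y (subset_tsupport f ?_)
  · exact right_ne_zero_of_mul hxy
  · exact left_ne_zero_of_mul hxy
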